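/- **Setting.** Let $\mathbf K=(\mathbf K,\prec_{\mathbf K})$ be an abstract elementary class (AEC) in a finitary vocabulary $\tau$, let $\kappa=LS(\mathbf K)$ be its Löwenheim–Skolem number (the least infinite cardinal $c\ge|\tau|$ such that every subset $A$ of a model $M\in\mathbf K$ is contained in a strong submodel of $M$ of size $\le |A|+c$; in particular $|\tau|\le\kappa$), put $\mu=2^\kappa$ and assume $\mu^{<\mu}=\mu$. *Presentation theory.* Fix compatible enumerations of the models of size $\kappa$ in $\mathbf K$: for each such $M$ a one-to-one enumeration $(m_i^M)_{i<\kappa}$ of its universe, so that $m_i^M\mapsto m_i^{M'}$ is an isomorphism whenever $M\cong M'$. The vocabulary $\tau^*$ is $\tau$ together with a $\kappa$-ary predicate $R_{[M]}$ for each isomorphism type $[M]$ of models of size $\kappa$ in $\mathbf K$, and a $(\kappa\times 2)$-ary predicate $R_{[M\prec N]}$ for each isomorphism type $[M\prec N]$ of pairs $M\prec_{\mathbf K}N$ of such models; here $(M,N)$ and $(M',N')$ have the same type if $M\cong M'$, $N\cong N'$ and the fixed isomorphisms $M\to M'$, $N\to N'$ agree on $M$, i.e. if also the maps $\pi:\kappa\to\kappa$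 with $m_i^M=m_{\pi(i)}^N$ are the same for both pairs. Let $V$ be a set of at least $\kappa^+$ variables, and $\mathbf x=(x_i)_{i<\kappa}$, $\mathbf y=(y_i)_{i<\kappa}$ one-to-one sequences from $V$ without common entries. $T^*$ consists of the following sentences, for all types $[M]$ and $[M\prec N]$ with associated $\pi$: 1. $\forall\mathbf x\,(R_{[M]}(\mathbf x)\to\phi(x_{i_1},\dots,x_{i_n}))$ for each atomic or negated atomic $\tau$-formula $\phi$ that holds of $m^M_{i_1},\dots,m^M_{i_n}$ in $M$; 2. $\forall\mathbf x,\mathbf y\,(R_{[M\prec N]}(\mathbf x,\mathbf y)\to R_{[M]}(\mathbf x)\wedge R_{[N]}(\mathbf y)\wedge\bigwedge_{i<\kappa}x_i=y_{\pi(i)})$; 3. $\forall\mathbf x\,\exists\mathbf y\,(\bigvee_{[M]}R_{[M]}(\mathbf y)\wedge\bigwedge_{i<\kappa}\bigvee_{j<\kappa}x_i=y_j)$; 4. $\forall\mathbf x\,(R_{[N]}(\mathbf x)\to R_{[M\prec N]}((x_{\pi(i)})_{i<\kappa},\mathbf x))$; 5. $\forall\mathbf x,\mathbf y\,(R_{[M]}(\mathbf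 x)\wedge R_{[N]}(\mathbf y)\wedge\bigwedge_{i<\kappa}x_i=y_{\pi(i)}\to R_{[M\prec N]}(\mathbf x,\mathbf y))$. The *canonical expansion* $M^*$ of a $\tau$-structure $M\in\mathbf K$ is the $\tau^*$-structure in which $R_{[M_0]}(\mathbf a)$ holds iff $\mathbf a$ enumerates a strong submodel of $M$ and $m_i^{M_0}\mapsto a_i$ is an isomorphism onto it, and $R_{[M_0\prec N_0]}(\mathbf a,\mathbf b)$ holds iff $\mathbf a$, $\mathbf b$ enumerate strong submodels of $M$ isomorphic in this way to $M_0$, $N_0$, and $a_i=b_j\Leftrightarrow m_i^{M_0}=m_j^{N_0}$. *Fragments.* $L_{\mu^+,\kappa^+}$ is built from atomic formulas by $\neg$, conjunctions of at most $\mu$ formulas and $\exists W$ for sets $W\subseteq V$ of at most $\kappa$ variables ($\vee,\to,\forall$ are abbreviations). A fragment is a set $\mathcal F$ of $L_{\mu^+,\kappa^+}(\tau^*)$-formulas with variables in $V$, each with at most $\kappa$ free variables, which contains all atomic formulas and is closed under subformulas, under (capture-free) substitution of a term for a free variable, under $\neg$, under $\exists v$ for $v\in V$, and under those conjunctions of fewer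 than $\mu$ formulas that have at most $\kappa$ free variables. For a fragment $\mathcal F$, $T_{\mathcal F}$ is the topology on the $\tau^*$-structures with universe $\kappa$ generated by the sets $\{M: M\models\phi(\bar\alpha)\}$, $\phi\in\mathcal F$, $\bar\alpha$ a tuple in $\kappa$. *$G$-Polish spaces.* Let $G$ be any totally ordered abelian group of degree $\mu$, i.e. whose set of positive elements has coinitiality $\mu$. A space is $G$-Polish if it has a base of size $\le\mu$ and its topology is given by the open balls of a metric with values in $G$ for which every Cauchy sequence of length $\mu$ converges. **Theorem.** There is a minimum fragment $\mathcal F$ (with set of variables $V$) that contains $T^*$. The $\tau$-reduct of every model of $T^*$ with universe $\kappa$ is in $\mathbf K$, and conversely for each $M\in\mathbf K$ with universe $\kappa$ the canonical expansion $M^*$ is a model of $T^*$. The space of all models of $T^*$ with universe $\kappa$, with the topology $T_{\mathcal F}$, is $G$-Polish; and so is the space $\mathbf K_\kappa$ of models in $\mathbf K$ with universe $\kappa$, identified with their canonical expansions, with the topology $T_{\mathcal F}$. -/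

import Mathlib

open scoped Cardinal FirstOrder
open FirstOrder.Language (Term Structure)

universe u

namespace AECTop

/-! ### Infinitary vocabularies, structures and formulas -/

/-- A vocabulary: a finitary vocabulary `lang` (function, constant and relation symbols) together
with further relation symbols of arbitrary, possibly infinite, arity. -/
structure Vocab where
  lang : FirstOrder.Language.{u, u}
  Sym : Type u
  arity : Sym → Type u

/-- A structure for the vocabulary `τ` with universe `A`. -/
structure Vocab.Str (τ : Vocab.{u}) (A : Type u) where
  base : τ.lang.Structure A
  rel : ∀ R : τ.Sym, (τ.arity R → A) → Prop

/-- Formulas of `L_{∞,∞}(τ)` with variables from `V`; primitives are the atomic formulas, negation,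
set-sized conjunctions and existential quantification over a set of variables. -/
inductive InfFormula (τ : Vocab.{u}) (V : Type u) : Type (u + 1)
  | eq (t₁ t₂ : τ.lang.Term V) : InfFormula τ V
  | rel {n : ℕ} (R : τ.lang.Relations n) (ts : Fin n → τ.lang.Term V) : InfFormula τ V
  | infRel (R : τ.Sym) (ts : τ.arity R → τ.lang.Term V) : InfFormula τ V
  | neg (φ : InfFormula τ V) : InfFormula τ V
  | conj {ι : Type u} (φ : ι → InfFormula τ V) : InfFormula τ V
  | ex (W : Set V) (φ : InfFormula τ V) : InfFormula τ V

/-- The variables that occur in a term. -/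
def termVars {L : FirstOrder.Language.{u, u}} {V : Type u} : L.Term V → Set V
  | .var v => {v}
  | .func _ ts => ⋃ i, termVars (ts i)

namespace InfFormula

variable {τ : Vocab.{u}} {V : Type u}

/-- Satisfaction of a formula in the structure `M` under the assignment `s`. -/
def Realize {A : Type u} (M : τ.Str A) : InfFormula τ V → (V → A) → Prop
  | eq t₁ t₂, s =>
      @Term.realize τ.lang A M.base V s t₁ = @Term.realize τ.lang A M.base V s t₂
  | rel R ts, s =>
      @Structure.RelMap τ.lang A M.base _ R (fun i => @Term.realize τ.lang A M.base V s (ts i))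
  | infRel R ts, s => M.rel R (fun i => @Term.realize τ.lang A M.base V s (ts i))
  | neg φ, s => ¬ φ.Realize M s
  | conj φ, s => ∀ i, (φ i).Realize M s
  | ex W φ, s => ∃ s' : V → A, (∀ v, v ∉ W → s' v = s v) ∧ φ.Realize M s'

/-- The free variables of a formula. -/
def freeVars : InfFormula τ V → Set V
  | eq t₁ t₂ => termVars t₁ ∪ termVars t₂
  | rel _ ts => ⋃ i, termVars (ts i)
  | infRel _ ts => ⋃ i, termVars (ts i)
  | neg φ => φ.freeVars
  | conj φ => ⋃ i, (φ i).freeVars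
  | ex W φ => φ.freeVars \ W

/-- `φ` is an `L_{μ⁺,κ⁺}`-formula as far as its connectives and quantifiers are concerned:
conjunctions have at most `μ` members and quantifiers bind at most `κ` variables. -/
def IsBounded (μ κ : Cardinal.{u}) : InfFormula τ V → Prop
  | eq _ _ => True
  | rel _ _ => True
  | infRel _ _ => True
  | neg φ => φ.IsBounded μ κ
  | conj (ι := ι) φ => #ι ≤ μ ∧ ∀ i, (φ i).IsBounded μ κ
  | ex W φ => #W ≤ κ ∧ φ.IsBounded μ κ

/-- Atomic formulas. -/
def IsAtomic : InfFormula τ V → Prop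
  | eq _ _ => True
  | rel _ _ => True
  | infRel _ _ => True
  | _ => False

/-- `Subformula ψ φ`: `ψ` is a subformula of `φ`. -/
inductive Subformula : InfFormula τ V → InfFormula τ V → Prop
  | refl (φ : InfFormula τ V) : Subformula φ φ
  | neg {ψ φ : InfFormula τ V} : Subformula ψ φ → Subformula ψ (neg φ)
  | conj {ψ : InfFormula τ V} {ι : Type u} {φ : ι → InfFormula τ V} (i : ι) :
      Subformula ψ (φ i) → Subformula ψ (conj φ)
  | ex {ψ φ : InfFormula τ V} (W : Set V) : Subformula ψ φ → Subformula ψ (ex W φ)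

open Classical in
/-- Substitution of the term `u` for the variable `v` in a term. -/
noncomputable def termSubst {L : FirstOrder.Language.{u, u}} (v : V) (u : L.Term V) (t : L.Term V) :
    L.Term V :=
  t.subst (Function.update Term.var v u)

open Classical in
/-- Substitution of the term `u` for all free occurrences of the variable `v`. -/
noncomputable def subst (v : V) (u : τ.lang.Term V) : InfFormula τ V → InfFormula τ V
  | eq t₁ t₂ => eq (termSubst v u t₁) (termSubst v u t₂)
  | rel R ts => rel R (fun i => termSubst v u (ts i))
  | infRel R ts => infRel R (fun i => termSubst v u (ts i))
  | neg φ => neg (φ.subst v u)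
  | conj φ => conj (fun i => (φ i).subst v u)
  | ex W φ => if v ∈ W then ex W φ else ex W (φ.subst v u)

/-- `u` is free for `v` in the formula: no variable of `u` becomes bound when `u` is substituted
for the free occurrences of `v`. -/
def FreeFor (v : V) (u : τ.lang.Term V) : InfFormula τ V → Prop
  | eq _ _ => True
  | rel _ _ => True
  | infRel _ _ => True
  | neg φ => φ.FreeFor v u
  | conj φ => ∀ i, (φ i).FreeFor v u
  | ex W φ => v ∈ φ.freeVars \ W → Disjoint (termVars u) W ∧ φ.FreeFor v u

/-! Defined connectives. -/

/-- Binary conjunction. -/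
def and (φ ψ : InfFormula τ V) : InfFormula τ V :=
  conj (fun b : ULift.{u} Bool => if b.down then φ else ψ)

/-- Set-sized disjunction. -/
def disj {ι : Type u} (φ : ι → InfFormula τ V) : InfFormula τ V :=
  neg (conj (fun i => neg (φ i)))

/-- Implication. -/
def imp (φ ψ : InfFormula τ V) : InfFormula τ V := neg (and φ (neg ψ))

/-- Universal quantification over a set of variables. -/
def all (W : Set V) (φ : InfFormula τ V) : InfFormula τ V := neg (ex W (neg φ))

end InfFormula

open InfFormula

/-- Fragments of `L_{μ⁺,κ⁺}(τ)` with set of variables `V`. -/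
structure IsFragment {τ : Vocab.{u}} {V : Type u} (μ κ : Cardinal.{u})
    (F : Set (InfFormula τ V)) : Prop where
  bounded : ∀ φ ∈ F, φ.IsBounded μ κ
  atomic : ∀ φ : InfFormula τ V, φ.IsAtomic → φ ∈ F
  subformula : ∀ φ ∈ F, ∀ ψ, Subformula ψ φ → ψ ∈ F
  subst : ∀ φ ∈ F, ∀ v ∈ φ.freeVars, ∀ t : τ.lang.Term V, φ.FreeFor v t → φ.subst v t ∈ F
  neg : ∀ φ ∈ F, neg φ ∈ F
  ex : ∀ φ ∈ F, ∀ v : V, ex {v} φ ∈ F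
  conj : ∀ (ι : Type u) (φ : ι → InfFormula τ V), #ι < μ → (∀ i, φ i ∈ F) →
    #(conj φ).freeVars ≤ κ → conj φ ∈ F
  card_freeVars : ∀ φ ∈ F, #φ.freeVars ≤ κ

/-- `M` is a model of the theory `T`. -/
def IsModel {τ : Vocab.{u}} {V A : Type u} (M : τ.Str A) (T : Set (InfFormula τ V)) : Prop :=
  ∀ φ ∈ T, ∀ s : V → A, φ.Realize M s

/-- The topology `T_F` on the space of `τ`-structures with universe `A`, generated by the sets of
structures that satisfy `φ` at a given tuple of elements of `A`, for `φ ∈ F`. -/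
def fragmentTopology {τ : Vocab.{u}} {V : Type u} (F : Set (InfFormula τ V)) (A : Type u) :
    TopologicalSpace (τ.Str A) :=
  TopologicalSpace.generateFrom
    {B | ∃ φ ∈ F, ∃ s : V → A, B = {M : τ.Str A | φ.Realize M s}}

/-! ### Abstract elementary classes -/

/-- An abstract elementary class in the vocabulary `L`. `Mem M` says that `M` belongs to the class,
and `Strong N S` says that the substructure `S` of `N` is a strong submodel of `N`. -/
structure AEC (L : FirstOrder.Language.{u, u}) where
  Mem : ∀ (M : Type u) [L.Structure M], Prop
  Strong : ∀ (N : Type u) [L.Structure N], L.Substructure N → Prop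
  /-- The class and the strong submodel relation are closed under isomorphism. -/
  mem_of_equiv : ∀ (M N : Type u) [L.Structure M] [L.Structure N], (M ≃[L] N) → Mem M → Mem N
  strong_of_equiv : ∀ (M N : Type u) [L.Structure M] [L.Structure N] (e : M ≃[L] N)
    (S : L.Substructure M), Strong M S → Strong N (S.map e.toHom)
  /-- The strong submodel relation is a partial order on the class, which refines the
  substructure relation. -/
  mem_left : ∀ (N : Type u) [L.Structure N] (S : L.Substructure N), Strong N S → Mem S
  mem_right : ∀ (N : Type u) [L.Structure N] (S : L.Substructure N), Strong N S → Mem N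
  refl : ∀ (N : Type u) [L.Structure N], Mem N → Strong N ⊤
  trans : ∀ (N : Type u) [L.Structure N] (S : L.Substructure N) (T : L.Substructure S),
    Strong N S → Strong S T → Strong N (T.map S.subtype.toHom)
  /-- Coherence. -/
  coherence : ∀ (N : Type u) [L.Structure N] (S₀ S₁ : L.Substructure N), S₀ ≤ S₁ →
    Strong N S₀ → Strong N S₁ → Strong S₁ (S₀.comap S₁.subtype.toHom)
  /-- Tarski-Vaught chain axioms: the union `N` of an increasing chain of strong submodels is in
  the class and is a strong extension of the members of the chain. -/
  chain_union : ∀ (N : Type u) [L.Structure N] (I : Type u) [LinearOrder I] [WellFoundedLT I]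
    [Nonempty I] (S : I → L.Substructure N),
    (∀ i j, i ≤ j → S i ≤ S j ∧ Strong (S j) ((S i).comap (S j).subtype.toHom)) →
    (∀ x : N, ∃ i, x ∈ S i) → Mem N ∧ ∀ i, Strong N (S i)
  /-- If all members of the chain are strong submodels of `N`, then so is their union. -/
  chain_upper : ∀ (N : Type u) [L.Structure N] (I : Type u) [LinearOrder I] [WellFoundedLT I]
    [Nonempty I] (S : I → L.Substructure N),
    (∀ i j, i ≤ j → S i ≤ S j ∧ Strong (S j) ((S i).comap (S j).subtype.toHom)) →
    (∀ i, Strong N (S i)) → Strong N (⨆ i, S i)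
  /-- Downward Löwenheim-Skolem. -/
  exists_ls : ∃ c : Cardinal.{u}, ∀ (M : Type u) [L.Structure M], Mem M → ∀ A : Set M,
    ∃ S : L.Substructure M, Strong M S ∧ A ⊆ S ∧ #S ≤ #A + c

/-- `κ = LS(K)`: the least infinite cardinal `c ≥ |L|` such that every subset `A` of a
model in `K` is contained in a strong submodel of size at most `|A| + c`. -/
def AEC.IsLS {L : FirstOrder.Language.{u, u}} (K : AEC L) (κ : Cardinal.{u}) : Prop :=
  IsLeast {c : Cardinal.{u} | ℵ₀ ≤ c ∧ L.card ≤ c ∧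
    ∀ (M : Type u) [L.Structure M], K.Mem M → ∀ A : Set M,
      ∃ S : L.Substructure M, K.Strong M S ∧ A ⊆ S ∧ #S ≤ #A + c} κ

/-- The cardinal `κ` as a set, namely the set of ordinals below `κ`. -/
abbrev Univ (κ : Cardinal.{u}) : Type u := κ.ord.ToType

/-- Compatible enumerations of the models of size `κ` in `K`: a one-to-one enumeration
`i ↦ m_i^M` (`i < κ`) of each such model, such that for isomorphic models `M`, `M'` the map
`m_i^M ↦ m_i^{M'}` is an isomorphism. (The isomorphisms so fixed commute with one another, as each
of them is determined by the enumerations.) -/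
structure CompatibleEnum {L : FirstOrder.Language.{u, u}} (K : AEC L) (κ : Cardinal.{u}) where
  enum : ∀ (M : Type u) [L.Structure M], K.Mem M → #M = κ → (Univ κ ≃ M)
  compatible : ∀ (M M' : Type u) [L.Structure M] [L.Structure M'] (hM : K.Mem M) (cM : #M = κ)
    (hM' : K.Mem M') (cM' : #M' = κ), Nonempty (M ≃[L] M') →
    ∃ f : M ≃[L] M', ∀ i, f (enum M hM cM i) = enum M' hM' cM' i

section Presentation

variable {L : FirstOrder.Language.{u, u}} {K : AEC L} {κ : Cardinal.{u}} (E : CompatibleEnum K κ)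

/-- The structure on `κ` that makes the enumeration `i ↦ m_i^M` an isomorphism onto `M`. By
compatibility it depends only on the isomorphism type of `M`, and it determines this type. -/
def CompatibleEnum.code (M : Type u) [L.Structure M] (hM : K.Mem M) (cM : #M = κ) :
    L.Structure (Univ κ) :=
  (E.enum M hM cM).symm.inducedStructure

/-- The isomorphism types `[M]` of models of size `κ` in `K`, given by their codes. -/
def CompatibleEnum.ModelType : Type u :=
  {C : L.Structure (Univ κ) // ∃ (M : Type u) (_ : L.Structure M) (hM : K.Mem M) (cM : #M = κ),
    C = E.code M hM cM}

/-- The isomorphism types `[M ≺ N]` of pairs of models of size `κ` in `K`, with respect to the fixed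
isomorphisms: `(M, N)` and `(M', N')` have the same type if `M ≅ M'`, `N ≅ N'` and
the fixed isomorphisms `M → M'` and `N → N'` agree on `M`. So the type consists of the types `[M]`
and `[N]` and of the map `π : κ → κ` with `m_i^M = m_{π(i)}^N`. -/
structure CompatibleEnum.PairType : Type u where
  sub : E.ModelType
  sup : E.ModelType
  π : Univ κ → Univ κ
  exists_pair : ∃ (N : Type u) (_ : L.Structure N) (S : L.Substructure N) (hS : K.Strong N S)
    (cN : #N = κ) (cS : #S = κ),
    sub.1 = E.code S (K.mem_left N S hS) cS ∧ sup.1 = E.code N (K.mem_right N S hS) cN ∧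
    ∀ i, (E.enum S (K.mem_left N S hS) cS i : N) = E.enum N (K.mem_right N S hS) cN (π i)

/-- The vocabulary `τ*`: the vocabulary `L` with a `κ`-ary predicate `R_[M]` for each isomorphism
type `[M]` and a `(κ × 2)`-ary predicate `R_[M ≺ N]` for each isomorphism type `[M ≺ N]`. -/
def CompatibleEnum.starVocab : Vocab.{u} where
  lang := L
  Sym := E.ModelType ⊕ E.PairType
  arity := Sum.elim (fun _ => Univ κ) (fun _ => Univ κ ⊕ Univ κ)

variable {V : Type u}

/-- The atomic formula `R_[M](x)`. -/
def CompatibleEnum.modelAtom (C : E.ModelType) (x : Univ κ → V) : InfFormula E.starVocab V :=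
  InfFormula.infRel (τ := E.starVocab) (Sum.inl C) (fun i : Univ κ => Term.var (x i))

/-- The atomic formula `R_[M ≺ N](x, y)`. -/
def CompatibleEnum.pairAtom (P : E.PairType) (x y : Univ κ → V) : InfFormula E.starVocab V :=
  InfFormula.infRel (τ := E.starVocab) (Sum.inr P)
    (fun i : Univ κ ⊕ Univ κ => Term.var (Sum.elim x y i))

/-- The formula `v = w` for variables `v`, `w`. -/
def CompatibleEnum.varEq (v w : V) : InfFormula E.starVocab V :=
  InfFormula.eq (τ := E.starVocab) (Term.var v) (Term.var w)

/-- The presentation theory `T*`, written with the `κ`-sequences of variables `x` and `y`. -/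
inductive CompatibleEnum.Theory (x y : Univ κ → V) : Set (InfFormula E.starVocab V)
  /-- If `R_[M](x)`, then `x_i ↦ m_i^M` is an isomorphism: for each atomic or negated atomic
  `L`-formula that holds of a tuple `m_i^M`, it holds of the corresponding `x_i`. -/
  | eq (C : E.ModelType) (t₁ t₂ : L.Term (Univ κ))
      (h : @Term.realize L _ C.1 _ id t₁ = @Term.realize L _ C.1 _ id t₂) :
      Theory x y (all (Set.range x) (imp (E.modelAtom C x)
        (InfFormula.eq (τ := E.starVocab) (t₁.relabel x) (t₂.relabel x))))
  | ne (C : E.ModelType) (t₁ t₂ : L.Term (Univ κ))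
      (h : @Term.realize L _ C.1 _ id t₁ ≠ @Term.realize L _ C.1 _ id t₂) :
      Theory x y (all (Set.range x) (imp (E.modelAtom C x)
        (neg (InfFormula.eq (τ := E.starVocab) (t₁.relabel x) (t₂.relabel x)))))
  | rel (C : E.ModelType) (n : ℕ) (R : L.Relations n) (ts : Fin n → L.Term (Univ κ))
      (h : @Structure.RelMap L _ C.1 n R (fun k => @Term.realize L _ C.1 _ id (ts k))) :
      Theory x y (all (Set.range x) (imp (E.modelAtom C x)
        (InfFormula.rel (τ := E.starVocab) R (fun k => (ts k).relabel x))))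
  | not_rel (C : E.ModelType) (n : ℕ) (R : L.Relations n) (ts : Fin n → L.Term (Univ κ))
      (h : ¬ @Structure.RelMap L _ C.1 n R (fun k => @Term.realize L _ C.1 _ id (ts k))) :
      Theory x y (all (Set.range x) (imp (E.modelAtom C x)
        (neg (InfFormula.rel (τ := E.starVocab) R (fun k => (ts k).relabel x)))))
  /-- If `R_[M ≺ N](x, y)`, then `R_[M](x)`, `R_[N](y)` and the correct overlap occurs. -/
  | overlap (P : E.PairType) :
      Theory x y (all (Set.range x ∪ Set.range y) (imp (E.pairAtom P x y)
        (and (E.modelAtom P.sub x) (and (E.modelAtom P.sup y)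
          (conj (fun i : Univ κ => E.varEq (x i) (y (P.π i))))))))
  /-- Every `κ`-tuple is covered by a model. -/
  | cover :
      Theory x y (all (Set.range x) (ex (Set.range y)
        (and (disj (fun C : E.ModelType => E.modelAtom C y))
          (conj (fun i : Univ κ => disj (fun j : Univ κ => E.varEq (x i) (y j)))))))
  /-- If `R_[N](x)` and `M ≺ N`, then `R_[M ≺ N]` holds of the appropriate subtuple of `x`
  and `x`. -/
  | restrict (P : E.PairType) :
      Theory x y (all (Set.range x) (imp (E.modelAtom P.sup x)
        (E.pairAtom P (fun i => x (P.π i)) x)))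
  /-- Coherence. -/
  | coherence (P : E.PairType) :
      Theory x y (all (Set.range x ∪ Set.range y) (imp
        (and (E.modelAtom P.sub x) (and (E.modelAtom P.sup y)
          (conj (fun i : Univ κ => E.varEq (x i) (y (P.π i))))))
        (E.pairAtom P x y)))

/-- `x` enumerates a strong submodel of `M`, and `m_i^{M₀} ↦ x_i` is an isomorphism of the
model `M₀` coded by `C` onto this submodel. -/
def CompatibleEnum.EnumeratesStrong {A : Type u} (M : L.Structure A) (C : E.ModelType)
    (x : Univ κ → A) : Prop :=
  letI := M
  letI := C.1
  ∃ (S : L.Substructure A) (_ : K.Strong A S) (e : Univ κ ≃[L] S), ∀ i, (e i : A) = x i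

/-- The canonical expansion `M*` of a model `M` of `K`: `R_[M₀](x)` holds iff `x` enumerates a
strong submodel of `M` and `x_i ↦ m_i^{M₀}` is an isomorphism; and `R_[M₀ ≺ N₀](x, y)` holds iff
`x` and `y` enumerate strong submodels, `x_i ↦ m_i^{M₀}` and `y_i ↦ m_i^{N₀}` are isomorphisms,
and `x_i = y_j` iff `m_i^{M₀} = m_j^{N₀}`. -/
def CompatibleEnum.expansion {A : Type u} (M : L.Structure A) : E.starVocab.Str A where
  base := M
  rel := fun R => match R with
    | Sum.inl C => fun x => E.EnumeratesStrong M C x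
    | Sum.inr P => fun z : Univ κ ⊕ Univ κ → A =>
        E.EnumeratesStrong M P.sub (fun i => z (Sum.inl i)) ∧
        E.EnumeratesStrong M P.sup (fun j => z (Sum.inr j)) ∧
        ∀ i j, z (Sum.inl i) = z (Sum.inr j) ↔ P.π i = j

end Presentation

/-! ### Generalized Polish spaces -/

/-- The degree of an ordered group: the coinitiality of its set of positive elements. -/
noncomputable def deg (G : Type u) [AddCommGroup G] [LinearOrder G] : Cardinal.{u} :=
  Order.cof {ε : G // 0 < ε}ᵒᵈ

/-- `d` is a `G`-metric on `X`. -/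
structure IsGMetric {G : Type u} [AddCommGroup G] [LinearOrder G] {X : Type u}
    (d : X → X → G) : Prop where
  nonneg : ∀ x y, 0 ≤ d x y
  eq_zero_iff : ∀ x y, d x y = 0 ↔ x = y
  symm : ∀ x y, d x y = d y x
  triangle : ∀ x y z, d x z ≤ d x y + d y z

/-- The topology generated by the open balls of `d`. -/
def ballTopology {G : Type u} [AddCommGroup G] [LinearOrder G] {X : Type u}
    (d : X → X → G) : TopologicalSpace X :=
  TopologicalSpace.generateFrom {B | ∃ (x : X) (ε : G), 0 < ε ∧ B = {y | d x y < ε}}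

/-- Every Cauchy sequence of length `deg G` converges. -/
def IsCauchyComplete {G : Type u} [AddCommGroup G] [LinearOrder G] {X : Type u}
    (d : X → X → G) : Prop :=
  ∀ x : Univ (deg G) → X,
    (∀ ε : G, 0 < ε → ∃ α, ∀ β γ, α ≤ β → α ≤ γ → d (x β) (x γ) < ε) →
    ∃ a : X, ∀ ε : G, 0 < ε → ∃ α, ∀ β, α ≤ β → d (x β) a < ε

/-- The topology `t` is `G`-Polish: it is induced by a Cauchy-complete `G`-metric and has weight
at most `deg G`. -/
def IsGPolish (G : Type u) [AddCommGroup G] [LinearOrder G] {X : Type u}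
    (t : TopologicalSpace X) : Prop :=
  (∃ d : X → X → G, IsGMetric d ∧ t = ballTopology d ∧ IsCauchyComplete d) ∧
  ∃ B : Set (Set X), @TopologicalSpace.IsTopologicalBasis X t B ∧ #B ≤ deg G

end AECTop

/-! The argument replaces `T_F` by an explicit tree of equivalence relations. The instances `R(a)`
of the infinitary predicates in the universe `κ` number at most `2 ^ κ = μ`, so they can be indexed
injectively by `μ`. For `δ < μ`, the key of a model of `T*` consists of its reduct, the least index
of a true instance `R_[M](a)` with `a` surjective, and the indices below `δ` of its true instances.
Key classes refine as `δ` grows. Once `T_F` is known to be generated by these classes, a metric is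
`ε_δ` at the first `δ` where two keys differ, with `ε_δ` decreasing to `0` in `G`; the weight is at
most `μ` because `μ^{<μ} = μ` bounds the number of keys of each level (`isGPolish_keyTopology`,
`mk_range_key_le`).

Completeness (`exists_limit`): apart from the covering axiom, each axiom of `T*` concerns the reduct
and at most three instances, so it survives in limits. A covering instance could escape to ever
larger indices; the second component of the key prevents this. That component is locally constant,
so it does not alter the topology.

The fragment: call a formula tame if it has at most `κ` free variables and its truth at each tuple
is constant on some key class around each model. As `μ` is regular and `κ < μ`, tameness is
preserved by conjunctions of fewer than `μ` formulas and by `∃v` over the universe `κ`. Hence the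
bounded hereditarily tame formulas form a fragment (`isFragment_tame`). It contains `T*`
(`theory_subset_boundedTame`): long quantifiers there yield formulas valid in all models considered,
and the disjunction over all types `[M]`, possibly of size `μ`, is decided because reduct and tuple
leave one candidate for `[M]`. The minimum fragment is therefore the intersection of all fragments
containing `T*`. Being tame, its formulas define open sets of the key topology; conversely any
fragment contains the diagrams, conjunctions of fewer than `μ` literals, which define neighbourhoods
inside key classes.

Finally, `R_[M](a)` with `a` surjective determines a structure in `K` completely, so the space of
canonical expansions is discrete. -/

namespace AECTop

open InfFormula

/-! ### Substitution, subformulas and fragments -/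

section Terms

variable {L : FirstOrder.Language.{u, u}} {V : Type u}

theorem finite_termVars (t : L.Term V) : (termVars t).Finite := by
  induction t with
  | var v => exact Set.finite_singleton v
  | func f ts ih => exact Set.finite_iUnion ih

theorem realize_term_congr {A : Type u} [L.Structure A] (t : L.Term V) {s s' : V → A}
    (h : ∀ v ∈ termVars t, s v = s' v) : t.realize s = t.realize s' := by
  induction t with
  | var v => exact h v rfl
  | func f ts ih =>
    simp only [Term.realize]
    congr 1
    funext i
    exact ih i fun v hv => h v (Set.mem_iUnion.2 ⟨i, hv⟩)

open Classical in
theorem realize_termSubst {A : Type u} [L.Structure A] (v : V) (t r : L.Term V) (s : V → A) :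
    (termSubst v t r).realize s = r.realize (Function.update s v (t.realize s)) := by
  rw [termSubst, Term.realize_subst]
  congr 1
  funext w
  by_cases h : w = v
  · subst h; simp
  · simp [Function.update_of_ne h]

theorem termVars_termSubst (v : V) (t r : L.Term V) :
    termVars (termSubst v t r) ⊆ termVars r ∪ termVars t := by
  classical
  induction r with
  | var w =>
    by_cases h : w = v
    · subst h; simp [termSubst, Term.subst]
    · simp [termSubst, Term.subst, Function.update_of_ne h]
  | func f ts ih =>
    intro w hw
    obtain ⟨i, hi⟩ := Set.mem_iUnion.1 hw
    exact (ih i hi).imp (fun h => Set.mem_iUnion.2 ⟨i, h⟩) id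

theorem termSubst_of_notMem (v : V) (t r : L.Term V) (h : v ∉ termVars r) :
    termSubst v t r = r := by
  classical
  induction r with
  | var w =>
    have : w ≠ v := fun e => h (by simp [e, termVars])
    simp [termSubst, Term.subst, Function.update_of_ne this]
  | func f ts ih =>
    have : ∀ i, termSubst v t (ts i) = ts i := fun i =>
      ih i fun hi => h (Set.mem_iUnion.2 ⟨i, hi⟩)
    simp only [termSubst, Term.subst] at this ⊢
    congr 1
    funext i
    exact this i

end Terms

namespace InfFormula

variable {τ : Vocab.{u}} {V : Type u}

theorem realize_congr {A : Type u} (M : τ.Str A) (φ : InfFormula τ V) {s s' : V → A}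
    (h : ∀ v ∈ φ.freeVars, s v = s' v) : φ.Realize M s ↔ φ.Realize M s' := by
  let _ := M.base
  induction φ generalizing s s' with
  | eq t₁ t₂ =>
    simp only [Realize]
    rw [realize_term_congr t₁ fun v hv => h v (Or.inl hv),
      realize_term_congr t₂ fun v hv => h v (Or.inr hv)]
  | rel R ts =>
    simp only [Realize]
    have : ∀ i, (ts i).realize s = (ts i).realize s' := fun i =>
      realize_term_congr _ fun v hv => h v (Set.mem_iUnion.2 ⟨i, hv⟩)
    simp only [this]
  | infRel R ts =>
    simp only [Realize]
    have : ∀ i, (ts i).realize s = (ts i).realize s' := fun i =>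
      realize_term_congr _ fun v hv => h v (Set.mem_iUnion.2 ⟨i, hv⟩)
    simp only [this]
  | neg φ ih => exact not_congr (ih h)
  | conj φ ih => exact forall_congr' fun i => ih i fun v hv => h v (Set.mem_iUnion.2 ⟨i, hv⟩)
  | ex W φ ih =>
    classical
    have key : ∀ {s s' : V → A}, (∀ v ∈ (ex W φ).freeVars, s v = s' v) →
        (ex W φ).Realize M s → (ex W φ).Realize M s' := by
      rintro s s' h ⟨r, hr, hφ⟩
      refine ⟨fun v => if v ∈ W then r v else s' v, fun v hv => if_neg hv, (ih ?_).1 hφ⟩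
      intro v hv
      by_cases hW : v ∈ W
      · simp [hW]
      · simp only [hW, if_false]
        rw [hr v hW, h v ⟨hv, hW⟩]
    exact ⟨key h, key fun v hv => (h v hv).symm⟩

/-- Complements `FreeFor`, which demands nothing below a quantifier when `v` is not free there: in
that case the substitution must be vacuous. -/
theorem subst_of_notMem (v : V) (t : τ.lang.Term V) (φ : InfFormula τ V)
    (h : v ∉ φ.freeVars) : φ.subst v t = φ := by
  induction φ with
  | eq t₁ t₂ =>
    simp only [subst]
    rw [termSubst_of_notMem _ _ _ fun hv => h (Or.inl hv),
      termSubst_of_notMem _ _ _ fun hv => h (Or.inr hv)]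
  | rel R ts =>
    simp only [subst]
    congr 1
    funext i
    exact termSubst_of_notMem _ _ _ fun hv => h (Set.mem_iUnion.2 ⟨i, hv⟩)
  | infRel R ts =>
    simp only [subst]
    congr 1
    funext i
    exact termSubst_of_notMem _ _ _ fun hv => h (Set.mem_iUnion.2 ⟨i, hv⟩)
  | neg φ ih => simp only [subst]; rw [ih h]
  | conj φ ih =>
    simp only [subst]
    congr 1
    funext i
    exact ih i fun hv => h (Set.mem_iUnion.2 ⟨i, hv⟩)
  | ex W φ ih =>
    simp only [subst]
    split_ifs with hW
    · rfl
    · rw [ih fun hv => h ⟨hv, hW⟩]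

open Classical in
theorem realize_subst {A : Type u} (M : τ.Str A) (v : V) (t : τ.lang.Term V)
    (φ : InfFormula τ V) (hf : φ.FreeFor v t) (s : V → A) :
    (φ.subst v t).Realize M s ↔
      φ.Realize M (Function.update s v (@Term.realize τ.lang A M.base V s t)) := by
  let _ := M.base
  induction φ generalizing s with
  | eq t₁ t₂ => simp only [subst, Realize, realize_termSubst]
  | rel R ts => simp only [subst, Realize, realize_termSubst]
  | infRel R ts => simp only [subst, Realize, realize_termSubst]
  | neg φ ih => exact not_congr (ih hf s)
  | conj φ ih => exact forall_congr' fun i => ih i (hf i) s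
  | ex W φ ih =>
    by_cases hv : v ∈ (ex W φ).freeVars
    · have hW : v ∉ W := hv.2
      obtain ⟨hd, hφ⟩ := hf hv
      have ht : ∀ r : V → A, (∀ w, w ∉ W → r w = s w) → t.realize r = t.realize s :=
        fun r hr => realize_term_congr t fun w hw => hr w (Set.disjoint_left.1 hd hw)
      simp only [subst, if_neg hW, Realize]
      constructor
      · rintro ⟨r, hr, h⟩
        refine ⟨Function.update r v (t.realize s), fun w hw => ?_, ?_⟩
        · by_cases e : w = v
          · subst e; simp
          · simp [Function.update_of_ne e, hr w hw]
        · rw [← ht r hr]; exact (ih hφ r).1 h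
      · rintro ⟨r, hr, h⟩
        have hr' : ∀ w, w ∉ W → Function.update r v (s v) w = s w := fun w hw => by
          by_cases e : w = v
          · subst e; simp
          · simp [Function.update_of_ne e, hr w hw]
        -- `v ∉ W`, so the witness must agree with `s` at `v`; `r` itself has the value of `t`
        -- there, which the induction hypothesis puts back.
        refine ⟨Function.update r v (s v), hr', (ih hφ _).2 ?_⟩
        rw [ht _ hr', Function.update_idem]
        have : Function.update r v (t.realize s) = r := by
          rw [Function.update_eq_self_iff, hr v hW]; simp
        rwa [this]
    · rw [subst_of_notMem _ _ _ hv]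
      refine realize_congr M _ fun w hw => ?_
      have : w ≠ v := fun e => hv (e ▸ hw)
      simp [Function.update_of_ne this]

theorem freeVars_subst (v : V) (t : τ.lang.Term V) (φ : InfFormula τ V) :
    (φ.subst v t).freeVars ⊆ φ.freeVars ∪ termVars t := by
  induction φ with
  | eq t₁ t₂ =>
    rintro w (hw | hw)
    · exact (termVars_termSubst _ _ _ hw).imp Or.inl id
    · exact (termVars_termSubst _ _ _ hw).imp Or.inr id
  | rel R ts =>
    intro w hw
    obtain ⟨i, hi⟩ := Set.mem_iUnion.1 hw
    exact (termVars_termSubst _ _ _ hi).imp (fun h => Set.mem_iUnion.2 ⟨i, h⟩) id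
  | infRel R ts =>
    intro w hw
    obtain ⟨i, hi⟩ := Set.mem_iUnion.1 hw
    exact (termVars_termSubst _ _ _ hi).imp (fun h => Set.mem_iUnion.2 ⟨i, h⟩) id
  | neg φ ih => exact ih
  | conj φ ih =>
    intro w hw
    obtain ⟨i, hi⟩ := Set.mem_iUnion.1 hw
    exact (ih i hi).imp (fun h => Set.mem_iUnion.2 ⟨i, h⟩) id
  | ex W φ ih =>
    simp only [subst]
    split_ifs with hW
    · exact Set.subset_union_left
    · exact fun w hw => (ih hw.1).imp (fun h => ⟨h, hw.2⟩) id

theorem IsBounded.subst {μ κ : Cardinal.{u}} (v : V) (t : τ.lang.Term V) {φ : InfFormula τ V}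
    (h : φ.IsBounded μ κ) : (φ.subst v t).IsBounded μ κ := by
  induction φ with
  | eq t₁ t₂ => trivial
  | rel R ts => trivial
  | infRel R ts => trivial
  | neg φ ih => exact ih h
  | conj φ ih => exact ⟨h.1, fun i => ih i (h.2 i)⟩
  | ex W φ ih =>
    simp only [InfFormula.subst]
    split_ifs with hW
    · exact h
    · exact ⟨h.1, ih h.2⟩

/-- Each subformula of `φ` has the property `Q`. -/
def Hereditarily (Q : InfFormula τ V → Prop) (φ : InfFormula τ V) : Prop :=
  ∀ ψ, Subformula ψ φ → Q ψ

section Hereditarily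

variable {Q : InfFormula τ V → Prop}

theorem Hereditarily.self {φ : InfFormula τ V} (h : Hereditarily Q φ) : Q φ := h φ (.refl φ)

theorem hereditarily_of_isAtomic {φ : InfFormula τ V} (hφ : φ.IsAtomic) (h : Q φ) :
    Hereditarily Q φ := by
  intro ψ hψ
  cases hψ with
  | refl => exact h
  | neg => exact hφ.elim
  | conj => exact hφ.elim
  | ex => exact hφ.elim

theorem hereditarily_neg {φ : InfFormula τ V} (hφ : Hereditarily Q φ) (h : Q (neg φ)) :
    Hereditarily Q (neg φ) := by
  intro ψ hψ
  cases hψ with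
  | refl => exact h
  | neg h' => exact hφ _ h'

theorem hereditarily_conj {ι : Type u} {φ : ι → InfFormula τ V}
    (hφ : ∀ i, Hereditarily Q (φ i)) (h : Q (conj φ)) : Hereditarily Q (conj φ) := by
  intro ψ hψ
  cases hψ with
  | refl => exact h
  | conj i h' => exact hφ i _ h'

theorem hereditarily_ex {W : Set V} {φ : InfFormula τ V} (hφ : Hereditarily Q φ)
    (h : Q (ex W φ)) : Hereditarily Q (ex W φ) := by
  intro ψ hψ
  cases hψ with
  | refl => exact h
  | ex _ h' => exact hφ _ h'

theorem Subformula.trans {χ ψ φ : InfFormula τ V} (h₁ : Subformula χ ψ) (h₂ : Subformula ψ φ) :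
    Subformula χ φ := by
  induction h₂ with
  | refl => exact h₁
  | neg _ ih => exact .neg ih
  | conj i _ ih => exact .conj i ih
  | ex W _ ih => exact .ex W ih

theorem IsBounded.of_subformula {μ κ : Cardinal.{u}} {ψ φ : InfFormula τ V}
    (h : Subformula ψ φ) (hφ : φ.IsBounded μ κ) : ψ.IsBounded μ κ := by
  induction h with
  | refl => exact hφ
  | neg _ ih => exact ih hφ
  | conj i _ ih => exact ih (hφ.2 i)
  | ex W _ ih => exact ih hφ.2

/-- By induction on `φ`: each node of the new formula is the substitution instance of a node of `φ`,
and `FreeFor` passes down to it. Only below a quantifier where `v` is not free can `FreeFor` be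
lost, and there nothing changes. -/
theorem Hereditarily.subst {v : V} {t : τ.lang.Term V}
    (hQ : ∀ ψ, Q ψ → ψ.FreeFor v t → Q (ψ.subst v t)) {φ : InfFormula τ V}
    (hφ : Hereditarily Q φ) (hf : φ.FreeFor v t) : Hereditarily Q (φ.subst v t) := by
  induction φ with
  | eq t₁ t₂ => exact hereditarily_of_isAtomic trivial (hQ _ hφ.self hf)
  | rel R ts => exact hereditarily_of_isAtomic trivial (hQ _ hφ.self hf)
  | infRel R ts => exact hereditarily_of_isAtomic trivial (hQ _ hφ.self hf)
  | neg φ ih => exact hereditarily_neg (ih (fun ψ h => hφ ψ (.neg h)) hf) (hQ _ hφ.self hf)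
  | conj φ ih =>
    exact hereditarily_conj (fun i => ih i (fun ψ h => hφ ψ (.conj i h)) (hf i))
      (hQ _ hφ.self hf)
  | ex W φ ih =>
    by_cases hv : v ∈ (InfFormula.ex W φ).freeVars
    · have h := hQ _ hφ.self hf
      simp only [InfFormula.subst, if_neg hv.2] at h ⊢
      exact hereditarily_ex (ih (fun ψ h => hφ ψ (.ex W h)) (hf hv).2) h
    · rwa [subst_of_notMem _ _ _ hv]

end Hereditarily

end InfFormula

/-- The bounded formulas all of whose subformulas have a property that is suitably closed form a
fragment. -/
theorem isFragment_hereditarily {τ : Vocab.{u}} {V : Type u} {μ κ : Cardinal.{u}}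
    (hκ : ℵ₀ ≤ κ) {Q : InfFormula τ V → Prop} (card : ∀ φ, Q φ → #φ.freeVars ≤ κ)
    (atomic : ∀ φ, φ.IsAtomic → Q φ)
    (subst : ∀ φ v t, Q φ → φ.FreeFor v t → Q (φ.subst v t))
    (neg : ∀ φ, Q φ → Q (neg φ)) (ex : ∀ φ v, Q φ → Q (ex {v} φ))
    (conj : ∀ (ι : Type u) (φ : ι → InfFormula τ V), #ι < μ → (∀ i, Q (φ i)) →
      #(conj φ).freeVars ≤ κ → Q (conj φ)) :
    IsFragment μ κ {φ : InfFormula τ V | φ.IsBounded μ κ ∧ Hereditarily Q φ} where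
  bounded φ h := h.1
  atomic φ h := ⟨by cases φ <;> trivial,
    hereditarily_of_isAtomic h (atomic φ h)⟩
  subformula φ h ψ hψ := ⟨h.1.of_subformula hψ, fun χ hχ => h.2 χ (hχ.trans hψ)⟩
  subst φ h v _ t hf := ⟨h.1.subst v t, h.2.subst (fun ψ hψ hf => subst ψ v t hψ hf) hf⟩
  neg φ h := ⟨h.1, hereditarily_neg h.2 (neg φ h.2.self)⟩
  ex φ h v := ⟨⟨by simpa using Cardinal.one_le_aleph0.trans hκ, h.1⟩,
    hereditarily_ex h.2 (ex φ v h.2.self)⟩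
  conj ι φ hι h hc := ⟨⟨hι.le, fun i => (h i).1⟩,
    hereditarily_conj (fun i => (h i).2) (conj ι φ hι (fun i => (h i).2.self) hc)⟩
  card_freeVars φ h := card φ h.2.self

/-- If some fragment contains `T`, then there is a least one. -/
theorem isLeast_sInter_fragment {τ : Vocab.{u}} {V : Type u} {μ κ : Cardinal.{u}}
    {T F₀ : Set (InfFormula τ V)} (h₀ : IsFragment μ κ F₀) (hT : T ⊆ F₀) :
    IsLeast {F | IsFragment μ κ F ∧ T ⊆ F} (⋂₀ {F | IsFragment μ κ F ∧ T ⊆ F}) := by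
  refine ⟨⟨?_, fun φ hφ F hF => hF.2 hφ⟩, fun F hF => Set.sInter_subset_of_mem hF⟩
  exact
    { bounded := fun φ h => h₀.bounded φ (h _ ⟨h₀, hT⟩)
      atomic := fun φ h F hF => hF.1.atomic φ h
      subformula := fun φ h ψ hψ F hF => hF.1.subformula φ (h F hF) ψ hψ
      subst := fun φ h v hv t hf F hF => hF.1.subst φ (h F hF) v hv t hf
      neg := fun φ h F hF => hF.1.neg φ (h F hF)
      ex := fun φ h v F hF => hF.1.ex φ (h F hF) v
      conj := fun ι φ hι h hc F hF => hF.1.conj ι φ hι (fun i => h i F hF) hc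
      card_freeVars := fun φ h => h₀.card_freeVars φ (h _ ⟨h₀, hT⟩) }

namespace InfFormula

variable {τ : Vocab.{u}} {V A : Type u} (M : τ.Str A) (s : V → A)

@[simp] theorem realize_neg (φ : InfFormula τ V) : (neg φ).Realize M s ↔ ¬ φ.Realize M s := Iff.rfl

@[simp] theorem realize_conj {ι : Type u} (φ : ι → InfFormula τ V) :
    (conj φ).Realize M s ↔ ∀ i, (φ i).Realize M s := Iff.rfl

@[simp] theorem realize_and (φ ψ : InfFormula τ V) :
    (and φ ψ).Realize M s ↔ φ.Realize M s ∧ ψ.Realize M s := by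
  simp only [and, realize_conj]
  exact ⟨fun h => ⟨h ⟨true⟩, h ⟨false⟩⟩, fun h => by rintro ⟨_ | _⟩ <;> simp [h.1, h.2]⟩

@[simp] theorem realize_disj {ι : Type u} (φ : ι → InfFormula τ V) :
    (disj φ).Realize M s ↔ ∃ i, (φ i).Realize M s := by
  simp [disj]

@[simp] theorem realize_imp (φ ψ : InfFormula τ V) :
    (imp φ ψ).Realize M s ↔ (φ.Realize M s → ψ.Realize M s) := by
  simp [imp]

/-- Since `IsModel` ranges over all assignments, outer universal quantifiers of the axioms can be
dropped. -/
theorem forall_realize_all (W : Set V) (φ : InfFormula τ V) :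
    (∀ s, (all W φ).Realize M s) ↔ ∀ s, φ.Realize M s := by
  simp only [all, realize_neg, Realize, not_exists, not_and, not_not]
  exact ⟨fun h s => h s s fun _ _ => rfl, fun h _ s' _ => h s'⟩

end InfFormula

/-! ### Regularity of `μ` and scales in ordered groups -/

section Cofinality

/-- König: `μ < μ ^ cof μ`, whereas `cof μ < μ` would give `μ ^ cof μ ≤ μ^{<μ} = μ`. -/
theorem cof_univ_of_powerlt {μ : Cardinal.{u}} (h0 : ℵ₀ ≤ μ) (hpow : μ ^< μ = μ) :
    Order.cof (Univ μ) = μ := by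
  rw [Ordinal.cof_toType]
  refine (Ordinal.cof_ord_le μ).antisymm (not_lt.1 fun h => ?_)
  exact (Cardinal.lt_power_cof_ord h0).not_ge ((Cardinal.le_powerlt μ h).trans_eq hpow)

theorem exists_forall_lt_of_lt_cof {P ι : Type u} [LinearOrder P] (g : ι → P)
    (h : #ι < Order.cof P) : ∃ p, ∀ i, g i < p := by
  have : ¬ IsCofinal (Set.range g) := fun hc =>
    ((Order.cof_le hc).trans Cardinal.mk_range_le).not_gt h
  obtain ⟨p, hp⟩ := not_isCofinal_iff.1 this
  exact ⟨p, fun i => hp _ ⟨i, rfl⟩⟩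

theorem mk_Iio_univ_lt {c : Cardinal.{u}} (i : Univ c) : #(Set.Iio i) < c := by
  simpa using Cardinal.mk_Iio_lt i

/-- A linear order has a monotone cofinal sequence whose length is its cofinality. -/
theorem exists_monotone_cofinal (P : Type u) [LinearOrder P] :
    ∃ f : Univ (Order.cof P) → P, Monotone f ∧ ∀ p, ∃ δ, p ≤ f δ := by
  obtain ⟨S, hS, hc⟩ := Order.exists_cof_eq P
  have e : Nonempty (Univ (Order.cof P) ≃ S) := by
    rw [← Cardinal.eq, Cardinal.mk_ord_toType, hc]
  obtain ⟨e⟩ := e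
  -- Recursion step: the fewer than `cof P` earlier values are bounded, which gives monotonicity,
  -- and the maximum with `e δ` gives cofinality.
  have step : ∀ (δ : Univ (Order.cof P)) (g : ∀ γ, γ < δ → P),
      ∃ p, (e δ : P) ≤ p ∧ ∀ γ (h : γ < δ), g γ h ≤ p := by
    intro δ g
    obtain ⟨p, hp⟩ := exists_forall_lt_of_lt_cof (fun γ : Set.Iio δ => g γ.1 γ.2)
      (mk_Iio_univ_lt δ)
    exact ⟨max (e δ) p, le_max_left _ _, fun γ h => (hp ⟨γ, h⟩).le.trans (le_max_right _ _)⟩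
  choose F hF₁ hF₂ using step
  have wf : WellFounded ((· < ·) : Univ (Order.cof P) → _ → Prop) := wellFounded_lt
  refine ⟨wf.fix F, ?_, fun p => ?_⟩
  · intro γ δ h
    rcases h.eq_or_lt with rfl | h
    · exact le_rfl
    · rw [wf.fix_eq F δ]
      exact hF₂ δ (fun γ _ => wf.fix F γ) γ h
  · obtain ⟨s, hs, hps⟩ := hS p
    refine ⟨e.symm ⟨s, hs⟩, hps.trans ?_⟩
    rw [wf.fix_eq]
    simpa using hF₁ (e.symm ⟨s, hs⟩) (fun γ _ => wf.fix F γ)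

/-- A decreasing sequence of positive elements that tends to `0` in an ordered group. -/
theorem exists_antitone_scale (G : Type u) [AddCommGroup G] [LinearOrder G]
    (h0 : ℵ₀ ≤ deg G) :
    ∃ ε : Univ (deg G) → G, (∀ δ, 0 < ε δ) ∧ Antitone ε ∧ ∀ g, 0 < g → ∃ δ, ε δ < g := by
  obtain ⟨f, hf, hc⟩ := exists_monotone_cofinal {ε : G // 0 < ε}ᵒᵈ
  refine ⟨fun δ => (OrderDual.ofDual (f δ)).1, fun δ => (OrderDual.ofDual (f δ)).2,
    fun γ δ h => hf h, fun g hg => ?_⟩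
  -- A one-element family: as the degree exceeds `1`, some positive element lies strictly below `g`.
  -- This provides the strict inequality in `ε δ < g`.
  obtain ⟨p, hp⟩ := exists_forall_lt_of_lt_cof
    (fun _ : PUnit.{u + 1} => OrderDual.toDual (⟨g, hg⟩ : {ε : G // 0 < ε}))
    (by rw [Cardinal.mk_punit]; exact Cardinal.one_lt_aleph0.trans_le h0)
  obtain ⟨δ, hδ⟩ := hc p
  exact ⟨δ, (show (OrderDual.ofDual (f δ)).1 ≤ (OrderDual.ofDual p).1 from hδ).trans_lt
    (hp PUnit.unit)⟩

end Cofinality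

/-! ### Polish spaces from refining equivalence relations -/

section Keys

/-- The topology generated by the fibres of a family of maps. -/
abbrev keyTopology {I X T : Type u} (key : I → X → T) : TopologicalSpace X :=
  .generateFrom {B | ∃ δ x, B = {y | key δ y = key δ x}}

theorem keyTopology_isOpen {I X T : Type u} (key : I → X → T) {U : Set X}
    (hU : ∀ x ∈ U, ∃ δ, ∀ y, key δ y = key δ x → y ∈ U) : @IsOpen X (keyTopology key) U := by
  let _ := keyTopology key
  rw [isOpen_iff_mem_nhds]
  intro x hx
  obtain ⟨δ, hδ⟩ := hU x hx
  have ho : IsOpen {y | key δ y = key δ x} := TopologicalSpace.isOpen_generateFrom_of_mem ⟨δ, x, rfl⟩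
  exact Filter.mem_of_superset (ho.mem_nhds rfl) hδ

/-- The maps become finer with increasing index. -/
def Refines {I X T : Type u} [LE I] (key : I → X → T) : Prop :=
  ∀ ⦃δ δ' x y⦄, δ ≤ δ' → key δ' x = key δ' y → key δ x = key δ y

/-- A space whose topology is generated by a continuous decreasing sequence, of length `deg G`, of
equivalence relations with few classes is `G`-Polish if the sequence is separating and complete. -/
theorem isGPolish_keyTopology {X T : Type u} (G : Type u) [AddCommGroup G] [LinearOrder G]
    [IsOrderedAddMonoid G] (h0 : ℵ₀ ≤ deg G) (key : Univ (deg G) → X → T)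
    (mono : Refines key)
    (sep : ∀ x y, (∀ δ, key δ x = key δ y) → x = y)
    (complete : ∀ x : Univ (deg G) → X,
      (∀ δ, ∃ α, ∀ β γ, α ≤ β → α ≤ γ → key δ (x β) = key δ (x γ)) →
      ∃ a, ∀ δ, ∃ α, ∀ β, α ≤ β → key δ (x β) = key δ a)
    (card : ∀ δ, #(Set.range (key δ)) ≤ deg G) : IsGPolish G (keyTopology key) := by
  classical
  obtain ⟨ε, hε, anti, lim⟩ := exists_antitone_scale G h0
  have wf : WellFounded ((· < ·) : Univ (deg G) → _ → Prop) := wellFounded_lt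
  -- The distance is the scale value at the first level that distinguishes the points, and `0` if
  -- there is none.
  let d : X → X → G := fun x y =>
    if h : {δ | key δ x ≠ key δ y}.Nonempty then ε (wf.min _ h) else 0
  have d_lt : ∀ {δ x y}, d x y < ε δ → key δ x = key δ y := by
    intro δ x y h
    by_contra hne
    have hn : {δ | key δ x ≠ key δ y}.Nonempty := ⟨δ, hne⟩
    simp only [d, dif_pos hn] at h
    exact h.not_ge (anti (not_lt.1 (wf.not_lt_min _ hne)))
  -- Only `≤`, since the scale need not decrease strictly; `lim` supplies strictness where it is
  -- required.
  have d_le : ∀ {δ x y}, key δ x = key δ y → d x y ≤ ε δ := by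
    intro δ x y h
    by_cases hn : {δ | key δ x ≠ key δ y}.Nonempty
    · simp only [d, dif_pos hn]
      refine anti (not_lt.1 fun hlt => wf.min_mem _ hn (mono hlt.le h))
    · simp only [d, dif_neg hn]
      exact (hε δ).le
  have d_nonneg : ∀ x y, 0 ≤ d x y := by
    intro x y
    simp only [d]
    split_ifs
    · exact (hε _).le
    · exact le_rfl
  have metric : IsGMetric d := by
    refine ⟨d_nonneg, fun x y => ⟨fun h => sep x y fun δ => d_lt (h ▸ hε δ), ?_⟩, ?_, ?_⟩
    · rintro rfl
      simp [d]
    · intro x y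
      simp only [d, ne_comm]
    · intro x y z
      by_cases hn : {δ | key δ x ≠ key δ z}.Nonempty
      · have hm := wf.min_mem _ hn
        have hd : d x z = ε (wf.min _ hn) := dif_pos hn
        rw [hd]
        by_cases h₁ : d x y < ε (wf.min _ hn)
        -- Ultrametric argument: where `x` and `z` first differ, `y` cannot agree with both, so one
        -- summand alone is large enough.
        · have h₂ : ¬ d y z < ε (wf.min _ hn) := fun h₂ => hm ((d_lt h₁).trans (d_lt h₂))
          exact (not_lt.1 h₂).trans (le_add_of_nonneg_left (d_nonneg x y))
        · exact (not_lt.1 h₁).trans (le_add_of_nonneg_right (d_nonneg y z))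
      · have hd : d x z = 0 := dif_neg hn
        rw [hd]
        exact add_nonneg (d_nonneg x y) (d_nonneg y z)
  have : Nonempty (Univ (deg G)) := by
    rw [← Cardinal.mk_ne_zero_iff, Cardinal.mk_ord_toType]
    exact (Cardinal.aleph0_pos.trans_le h0).ne'
  refine ⟨⟨d, metric, le_antisymm ?_ ?_, ?_⟩, ?_⟩
  · refine le_generateFrom ?_
    rintro B ⟨x, g, hg, rfl⟩
    refine keyTopology_isOpen key fun y hy => ?_
    by_cases hxy : x = y
    · subst hxy
      obtain ⟨δ, hδ⟩ := lim g hg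
      exact ⟨δ, fun z hz => (d_le hz.symm).trans_lt hδ⟩
    · have hn : {δ | key δ x ≠ key δ y}.Nonempty := by
        by_contra hn
        exact hxy (sep x y fun δ => by_contra fun h => hn ⟨δ, h⟩)
      have hd : d x y = ε (wf.min _ hn) := dif_pos hn
      -- If `z` agrees with `y` at the level where `x` and `y` first differ, then `x` and `z` first
      -- differ at that same level, so `z` is no farther from the centre than `y`.
      refine ⟨wf.min _ hn, fun z hz => ?_⟩
      have : ¬ ε (wf.min _ hn) < d x z := by
        intro h
        by_cases hn' : {δ | key δ x ≠ key δ z}.Nonempty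
        · have hd' : d x z = ε (wf.min _ hn') := dif_pos hn'
          have hle : wf.min _ hn' ≤ wf.min _ hn :=
            not_lt.1 (wf.not_lt_min {δ | key δ x ≠ key δ z} fun h => wf.min_mem _ hn (h.trans hz))
          have hle' : wf.min _ hn ≤ wf.min _ hn' := by
            refine not_lt.1 (wf.not_lt_min {δ | key δ x ≠ key δ y} fun h => ?_)
            exact wf.min_mem _ hn' (h.trans (mono hle hz).symm)
          rw [hd', le_antisymm hle hle'] at h
          exact h.false
        · have hd' : d x z = 0 := dif_neg hn'
          exact (hd' ▸ h).not_gt (hε _)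
      exact (not_lt.1 this).trans_lt (hd ▸ hy)
  · refine le_generateFrom ?_
    rintro B ⟨δ, x, rfl⟩
    let _ := ballTopology d
    rw [isOpen_iff_mem_nhds]
    intro y hy
    have ho : IsOpen {z | d y z < ε δ} :=
      TopologicalSpace.isOpen_generateFrom_of_mem ⟨y, ε δ, hε δ, rfl⟩
    refine Filter.mem_of_superset (ho.mem_nhds ?_) fun z hz => (d_lt hz).symm.trans hy
    rw [Set.mem_ofPred_eq, (metric.eq_zero_iff y y).2 rfl]
    exact hε δ
  · intro x hx
    obtain ⟨a, ha⟩ := complete x fun δ => (hx (ε δ) (hε δ)).imp fun α h β γ hβ hγ =>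
      d_lt (h β γ hβ hγ)
    refine ⟨a, fun g hg => ?_⟩
    obtain ⟨δ, hδ⟩ := lim g hg
    exact (ha δ).imp fun α h β hβ => (d_le (h β hβ)).trans_lt hδ
  · refine ⟨{B | ∃ δ x, B = {y | key δ y = key δ x}}, ?_, ?_⟩
    · let _ := keyTopology key
      refine ⟨?_, ?_, rfl⟩
      · rintro _ ⟨δ, x, rfl⟩ _ ⟨δ', x', rfl⟩ z ⟨hz, hz'⟩
        exact ⟨_, ⟨max δ δ', z, rfl⟩, rfl, fun y hy =>
          ⟨(mono (le_max_left _ _) hy).trans hz, (mono (le_max_right _ _) hy).trans hz'⟩⟩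
      · refine Set.eq_univ_of_forall fun x => ?_
        exact ⟨_, ⟨Classical.arbitrary _, x, rfl⟩, rfl⟩
    · have hsub : {B | ∃ δ x, B = {y | key δ y = key δ x}} ⊆
          Set.range fun p : Σ δ, Set.range (key δ) => {y | key p.1 y = p.2} := by
        rintro _ ⟨δ, x, rfl⟩
        exact ⟨⟨δ, key δ x, x, rfl⟩, rfl⟩
      refine (Cardinal.mk_le_mk_of_subset hsub).trans (Cardinal.mk_range_le.trans ?_)
      rw [Cardinal.mk_sigma]
      refine (Cardinal.sum_le_sum _ (fun _ => deg G) card).trans ?_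
      rw [Cardinal.sum_const', Cardinal.mk_ord_toType, Cardinal.mul_eq_self h0]

end Keys

/-! ### Embeddings given by enumerations -/

section Embeddings

variable {L : FirstOrder.Language.{u, u}} {A D : Type u}

/-- The map `a` is an embedding of the structure `C` into the structure `B`. -/
structure EmbedsVia (B : L.Structure A) (C : L.Structure D) (a : D → A) : Prop where
  injective : Function.Injective a
  map_fun : ∀ {n : ℕ} (f : L.Functions n) (xs : Fin n → D),
    a (C.funMap f xs) = B.funMap f (a ∘ xs)
  map_rel : ∀ {n : ℕ} (R : L.Relations n) (xs : Fin n → D),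
    C.RelMap R xs ↔ B.RelMap R (a ∘ xs)

theorem structure_ext {B B' : L.Structure A}
    (hf : ∀ {n : ℕ} (f : L.Functions n) (xs : Fin n → A), B.funMap f xs = B'.funMap f xs)
    (hr : ∀ {n : ℕ} (R : L.Relations n) (xs : Fin n → A), B.RelMap R xs ↔ B'.RelMap R xs) :
    B = B' :=
  Structure.ext (by funext n f xs; exact hf f xs) (by funext n R xs; exact propext (hr R xs))

namespace EmbedsVia

variable {B : L.Structure A} {C : L.Structure D} {a : D → A}

theorem realize (h : EmbedsVia B C a) {V : Type u} (t : L.Term V) (s : V → D) :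
    @Term.realize L A B V (a ∘ s) t = a (@Term.realize L D C V s t) := by
  induction t with
  | var v => rfl
  | func f ts ih =>
    simp only [Term.realize, ih]
    exact (h.map_fun f _).symm

theorem source_unique {C' : L.Structure D} (h : EmbedsVia B C a) (h' : EmbedsVia B C' a) :
    C = C' :=
  structure_ext (fun f xs => h.injective ((h.map_fun f xs).trans (h'.map_fun f xs).symm))
    fun R xs => (h.map_rel R xs).trans (h'.map_rel R xs).symm

/-- Dually, a surjective tuple pushes its source structure onto the whole universe; this makes the
space of canonical expansions discrete. -/
theorem target_unique {B' : L.Structure A} (h : EmbedsVia B C a) (h' : EmbedsVia B' C a)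
    (ha : Function.Surjective a) : B = B' := by
  have hxs : ∀ {n : ℕ} (xs : Fin n → A), ∃ ys : Fin n → D, xs = a ∘ ys := fun xs => by
    choose g hg using ha
    exact ⟨g ∘ xs, funext fun i => (hg _).symm⟩
  refine structure_ext (fun f xs => ?_) fun R xs => ?_
  · obtain ⟨ys, rfl⟩ := hxs xs
    exact (h.map_fun f ys).symm.trans (h'.map_fun f ys)
  · obtain ⟨ys, rfl⟩ := hxs xs
    exact (h.map_rel R ys).symm.trans (h'.map_rel R ys)

theorem comp {D' : Type u} {C' : L.Structure D'} {b : D' → D} (h : EmbedsVia B C a)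
    (h' : EmbedsVia C C' b) : EmbedsVia B C' (a ∘ b) where
  injective := h.injective.comp h'.injective
  map_fun f xs := (congrArg a (h'.map_fun f xs)).trans (h.map_fun f _)
  map_rel R xs := (h'.map_rel R xs).trans (h.map_rel R _)

/-- A surjective embedding is an isomorphism. -/
theorem exists_equiv (h : EmbedsVia B C a) (ha : Function.Surjective a) :
    ∃ e : @FirstOrder.Language.Equiv L D A C B, ∀ i, e i = a i :=
  ⟨@FirstOrder.Language.Equiv.mk L D A C B (Equiv.ofBijective a ⟨h.injective, ha⟩)
    (fun f xs => h.map_fun f xs) (fun R xs => (h.map_rel R xs).symm), fun _ => rfl⟩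

end EmbedsVia

theorem embedsVia_of_equiv [B : L.Structure A] [C : L.Structure D] (e : D ≃[L] A) :
    EmbedsVia B C e :=
  ⟨e.injective, fun f xs => e.map_fun f xs, fun R xs => (e.map_rel R xs).symm⟩

theorem embedsVia_subtype [B : L.Structure A] (S : L.Substructure A) :
    EmbedsVia B (inferInstance : L.Structure S) (Subtype.val : S → A) :=
  ⟨Subtype.val_injective, fun _ _ => rfl, fun _ _ => Iff.rfl⟩

end Embeddings

/-! ### Canonical expansions and the semantics of the presentation theory -/

namespace CompatibleEnum

section Expansion

variable {L : FirstOrder.Language.{u, u}} {K : AEC L} {κ : Cardinal.{u}} (E : CompatibleEnum K κ)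

theorem embedsVia_code (M : Type u) [B : L.Structure M] (hM : K.Mem M) (cM : #M = κ) :
    EmbedsVia B (E.code M hM cM) (E.enum M hM cM) where
  injective := (E.enum M hM cM).injective
  map_fun _ _ := (E.enum M hM cM).apply_symm_apply _
  map_rel _ _ := Iff.rfl

theorem mem_modelType (C : E.ModelType) : @AEC.Mem L K (Univ κ) C.1 := by
  obtain ⟨_, M, _, hM, cM, rfl⟩ := C
  obtain ⟨e, -⟩ := (E.embedsVia_code M hM cM).exists_equiv (E.enum M hM cM).surjective
  let _ := E.code M hM cM
  exact K.mem_of_equiv M (Univ κ) e.symm hM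

/-- `π` followed by the enumeration of `N` is the enumeration of the submodel followed by inclusion;
the injective enumeration of `N` can be cancelled. -/
theorem embedsVia_pair (P : E.PairType) : EmbedsVia P.sup.1 P.sub.1 P.π := by
  obtain ⟨N, _, S, hS, cN, cS, h₁, h₂, h₃⟩ := P.exists_pair
  have h := (embedsVia_subtype S).comp (E.embedsVia_code S (K.mem_left N S hS) cS)
  have h' := E.embedsVia_code N (K.mem_right N S hS) cN
  have e : (Subtype.val : S → N) ∘ E.enum S (K.mem_left N S hS) cS =
      E.enum N (K.mem_right N S hS) cN ∘ P.π := funext h₃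
  rw [e, ← h₁] at h
  rw [← h₂] at h'
  refine ⟨h.injective.of_comp, fun f xs => h'.injective ?_, fun R xs => ?_⟩
  · exact (h.map_fun f xs).trans (h'.map_fun f _).symm
  · exact (h.map_rel R xs).trans (h'.map_rel R _).symm

/-- Separates what depends on the tuple as an embedding from what depends only on its range, namely
strength of the submodel. -/
theorem enumeratesStrong_iff {A : Type u} (B : L.Structure A) (C : E.ModelType) (a : Univ κ → A) :
    E.EnumeratesStrong B C a ↔ EmbedsVia B C.1 a ∧
      ∃ S : L.Substructure A, @AEC.Strong L K A B S ∧ (S : Set A) = Set.range a := by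
  let _ := B
  let _ := C.1
  constructor
  · rintro ⟨S, hS, e, he⟩
    have ha : a = Subtype.val ∘ e := funext fun i => (he i).symm
    refine ⟨ha ▸ (embedsVia_subtype S).comp (embedsVia_of_equiv e), S, hS, ?_⟩
    rw [ha, Set.range_comp, e.surjective.range_eq, Set.image_univ, Subtype.range_coe]
  · rintro ⟨h, S, hS, hr⟩
    have hmem : ∀ i, a i ∈ S := fun i => hr.symm.subset ⟨i, rfl⟩
    have h' : EmbedsVia (inferInstance : L.Structure S) C.1 fun i => (⟨a i, hmem i⟩ : S) :=
      ⟨fun i j hij => h.injective (congrArg Subtype.val hij),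
        fun f xs => Subtype.ext (h.map_fun f xs), fun R xs => h.map_rel R xs⟩
    obtain ⟨e, he⟩ := h'.exists_equiv fun s => by
      obtain ⟨i, hi⟩ := hr.subset s.2
      exact ⟨i, Subtype.ext hi⟩
    exact ⟨S, hS, e, fun i => by rw [he]⟩

/-- A pair type transports an enumeration of a strong submodel to one of a strong submodel of this
submodel. -/
theorem EnumeratesStrong.comp_pair {A : Type u} {B : L.Structure A} (P : E.PairType)
    {b : Univ κ → A} (h : E.EnumeratesStrong B P.sup b) :
    E.EnumeratesStrong B P.sub fun i => b (P.π i) := by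
  refine (E.enumeratesStrong_iff B P.sub _).2
    ⟨((E.enumeratesStrong_iff B P.sup b).1 h).1.comp (E.embedsVia_pair P), ?_⟩
  obtain ⟨T, hT, e, he⟩ := h
  obtain ⟨N, _, S, hS, cN, cS, h₁, h₂, h₃⟩ := P.exists_pair
  have hcode := E.embedsVia_code N (K.mem_right N S hS) cN
  rw [← h₂] at hcode
  let _ := B
  let _ := P.sup.1
  obtain ⟨g, hg⟩ := hcode.exists_equiv (Equiv.surjective _)
  -- `k` sends `m_i^N` to `b_i`. The strong submodel `S` of `N` is carried along `k` into `T`, and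
  -- transitivity makes its image strong in `A`.
  let k : N ≃[L] T := e.comp g.symm
  have hk : ∀ i, (k (E.enum N (K.mem_right N S hS) cN i) : A) = b i := by
    intro i
    rw [← hg i, ← he i]
    change ((e (g.symm (g i)) : T) : A) = e i
    rw [FirstOrder.Language.Equiv.symm_apply_apply]
  refine ⟨_, K.trans A T _ hT (K.strong_of_equiv N T k S hS), ?_⟩
  ext z
  constructor
  · rintro ⟨_, ⟨n, hn, rfl⟩, rfl⟩
    refine ⟨(E.enum S (K.mem_left N S hS) cS).symm ⟨n, hn⟩, ?_⟩
    have := h₃ ((E.enum S (K.mem_left N S hS) cS).symm ⟨n, hn⟩)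
    rw [Equiv.apply_symm_apply] at this
    change b (P.π _) = (k n : A)
    rw [← hk, ← this]
  · rintro ⟨i, rfl⟩
    refine ⟨k (E.enum N (K.mem_right N S hS) cN (P.π i)), ⟨_, ?_, rfl⟩, hk _⟩
    rw [← h₃]
    exact Subtype.prop _

end Expansion

section Models

variable {L : FirstOrder.Language.{u, u}} {K : AEC L} {κ : Cardinal.{u}} (E : CompatibleEnum K κ)
  {A : Type u}

/-- `R_[M](a)` holds in the structure. -/
def RelModel (M : E.starVocab.Str A) (C : E.ModelType) (a : Univ κ → A) : Prop :=
  M.rel (Sum.inl C : E.ModelType ⊕ E.PairType) a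

/-- `R_[M ≺ N](a, b)` holds in the structure. -/
def RelPair (M : E.starVocab.Str A) (P : E.PairType) (a b : Univ κ → A) : Prop :=
  M.rel (Sum.inr P : E.ModelType ⊕ E.PairType) (Sum.elim a b : Univ κ ⊕ Univ κ → A)

/-- The semantic content of the presentation theory for structures with universe `κ`. -/
structure Presents (M : E.starVocab.Str (Univ κ)) : Prop where
  embeds : ∀ C a, E.RelModel M C a → EmbedsVia (L := L) M.base C.1 a
  overlap : ∀ P a b, E.RelPair M P a b →
    E.RelModel M P.sub a ∧ E.RelModel M P.sup b ∧ ∀ i, a i = b (P.π i)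
  cover : ∃ C a, Function.Surjective a ∧ E.RelModel M C a
  restrict : ∀ P b, E.RelModel M P.sup b → E.RelPair M P (fun i => b (P.π i)) b
  coherence : ∀ P a b, E.RelModel M P.sub a → E.RelModel M P.sup b → (∀ i, a i = b (P.π i)) →
    E.RelPair M P a b

variable {V : Type u}

theorem realize_modelAtom (M : E.starVocab.Str A) (C : E.ModelType) (x : Univ κ → V) (s : V → A) :
    (E.modelAtom C x).Realize M s ↔ E.RelModel M C (s ∘ x) := Iff.rfl

theorem realize_pairAtom (M : E.starVocab.Str A) (P : E.PairType) (x y : Univ κ → V) (s : V → A) :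
    (E.pairAtom P x y).Realize M s ↔ E.RelPair M P (s ∘ x) (s ∘ y) := by
  rw [RelPair, ← Sum.comp_elim]
  rfl

theorem realize_varEq (M : E.starVocab.Str A) (v w : V) (s : V → A) :
    (E.varEq v w).Realize M s ↔ s v = s w := Iff.rfl

theorem exists_assignment [Nonempty A] {x y : Univ κ → V} (hx : Function.Injective x)
    (hy : Function.Injective y) (hxy : Disjoint (Set.range x) (Set.range y)) (s : V → A)
    (a b : Univ κ → A) : ∃ r : V → A, r ∘ x = a ∧ r ∘ y = b ∧
      ∀ v, v ∉ Set.range x → v ∉ Set.range y → r v = s v := by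
  refine ⟨Function.extend x a (Function.extend y b s), ?_, ?_, ?_⟩
  · exact funext fun i => hx.extend_apply _ _ i
  · funext i
    have : ¬ ∃ j, x j = y i := fun ⟨j, hj⟩ =>
      Set.disjoint_left.1 hxy ⟨j, hj⟩ ⟨i, rfl⟩
    simp [Function.extend_apply' _ _ _ this, hy.extend_apply]
  · intro v h₁ h₂
    rw [Function.extend_apply' _ _ _ h₁, Function.extend_apply' _ _ _ h₂]

/-- Injectivity and disjointness of `x` and `y` allow arbitrary pairs of tuples as values. The
covering axiom takes a simpler form because the universe has size `κ`: one `κ`-tuple lists all of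
it. -/
theorem isModel_iff_presents [Nonempty (Univ κ)] {x y : Univ κ → V} (hx : Function.Injective x)
    (hy : Function.Injective y) (hxy : Disjoint (Set.range x) (Set.range y))
    (M : E.starVocab.Str (Univ κ)) : IsModel M (E.Theory x y) ↔ E.Presents M := by
  have hs : ∀ a b : Univ κ → Univ κ, ∃ s : V → Univ κ, s ∘ x = a ∧ s ∘ y = b := fun a b =>
    (exists_assignment hx hy hxy (fun _ => Classical.arbitrary _) a b).imp fun s h => ⟨h.1, h.2.1⟩
  constructor
  · intro h
    refine ⟨fun C a ha => ?_, fun P a b hab => ?_, ?_, fun P b hb => ?_, fun P a b ha hb hab => ?_⟩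
    · obtain ⟨s, rfl, -⟩ := hs a a
      refine ⟨fun i j hij => ?_, fun {n} f xs => ?_, fun {n} R xs => ?_⟩
      · by_contra hne
        have := (forall_realize_all M _ _).1 (h _ (.ne C (Term.var i) (Term.var j) hne)) s
        exact (realize_imp _ _ _ _).1 this ha hij
      · have := (forall_realize_all M _ _).1 (h _ (.eq C
          (Term.var (@Structure.funMap L _ C.1 n f xs)) (Term.func f fun k => Term.var (xs k))
          rfl)) s
        exact (realize_imp _ _ _ _).1 this ha
      · constructor
        · intro hR
          have := (forall_realize_all M _ _).1 (h _ (.rel C n R (fun k => Term.var (xs k)) hR)) s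
          exact (realize_imp _ _ _ _).1 this ha
        · intro hR
          by_contra hC
          have := (forall_realize_all M _ _).1 (h _ (.not_rel C n R (fun k => Term.var (xs k)) hC)) s
          exact (realize_imp _ _ _ _).1 this ha hR
    · obtain ⟨s, rfl, rfl⟩ := hs a b
      have := (forall_realize_all M _ _).1 (h _ (.overlap P)) s
      simpa [realize_pairAtom, realize_modelAtom, realize_varEq, hab] using this
    -- With `x` listing the whole universe, a tuple that covers `x` is surjective.
    · obtain ⟨s, hsx, -⟩ := hs id id
      obtain ⟨r, hr, hr'⟩ := (forall_realize_all M _ _).1 (h _ .cover) s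
      simp only [realize_and, realize_disj, realize_conj, realize_modelAtom, realize_varEq] at hr'
      obtain ⟨⟨C, hC⟩, hc⟩ := hr'
      refine ⟨C, r ∘ y, fun i => ?_, hC⟩
      obtain ⟨j, hj⟩ := hc i
      refine ⟨j, hj.symm.trans ?_⟩
      rw [hr _ (Set.disjoint_left.1 hxy ⟨i, rfl⟩)]
      exact congrFun hsx i
    · obtain ⟨s, rfl, -⟩ := hs b b
      have := (forall_realize_all M _ _).1 (h _ (.restrict P)) s
      simp only [realize_imp, realize_pairAtom, realize_modelAtom] at this
      exact this hb
    · obtain ⟨s, rfl, rfl⟩ := hs a b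
      have := (forall_realize_all M _ _).1 (h _ (.coherence P)) s
      simp only [realize_imp, realize_pairAtom, realize_modelAtom, realize_and, realize_conj,
        realize_varEq] at this
      exact this ⟨ha, hb, hab⟩
  · intro h
    have hr : ∀ (C : E.ModelType) (s : V → Univ κ), E.RelModel M C (s ∘ x) →
        ∀ t : L.Term (Univ κ), @Term.realize L _ M.base V s (t.relabel x) =
          s (x (@Term.realize L _ C.1 _ id t)) := fun C s ha t =>
      (@Term.realize_relabel L _ M.base _ _ t x s).trans ((h.embeds C _ ha).realize t id)
    rintro _ (⟨C, t₁, t₂, ht⟩ | ⟨C, t₁, t₂, ht⟩ | ⟨C, n, R, ts, ht⟩ | ⟨C, n, R, ts, ht⟩ | P | _ |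
      P | P) <;> rw [forall_realize_all] <;> intro s
    · refine (realize_imp _ _ _ _).2 fun ha => ?_
      exact (hr C s ha t₁).trans ((congrArg (s ∘ x) ht).trans (hr C s ha t₂).symm)
    · refine (realize_imp _ _ _ _).2 fun ha => ?_
      exact fun e => ht ((h.embeds C _ ha).injective
        ((hr C s ha t₁).symm.trans (Eq.trans e (hr C s ha t₂))))
    · refine (realize_imp _ _ _ _).2 fun ha => ?_
      exact (congrArg (@Structure.RelMap L _ M.base n R)
        (funext fun k => hr C s ha (ts k))).mpr <| ((h.embeds C _ ha).map_rel R _).1 ht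
    · refine (realize_imp _ _ _ _).2 fun ha => ?_
      exact (congrArg (fun xs => ¬ @Structure.RelMap L _ M.base n R xs)
        (funext fun k => hr C s ha (ts k))).mpr <| (not_congr ((h.embeds C _ ha).map_rel R _)).1 ht
    · simp only [realize_imp, realize_pairAtom, realize_modelAtom, realize_and, realize_conj,
        realize_varEq]
      exact h.overlap P _ _
    · obtain ⟨C, a, hsurj, hC⟩ := h.cover
      obtain ⟨r, hrx, hry, hr⟩ := exists_assignment hx hy hxy s (s ∘ x) a
      refine ⟨r, fun v hv => ?_, ?_⟩
      · by_cases hvx : v ∈ Set.range x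
        · obtain ⟨i, rfl⟩ := hvx
          exact congrFun hrx i
        · exact hr v hvx hv
      · simp only [realize_and, realize_disj, realize_conj, realize_modelAtom, realize_varEq]
        exact ⟨⟨C, hry.symm ▸ hC⟩, fun i => (hsurj (r (x i))).imp fun j hj =>
          hj.symm.trans (congrFun hry j).symm⟩
    · simp only [realize_imp, realize_pairAtom, realize_modelAtom]
      exact h.restrict P _
    · simp only [realize_imp, realize_pairAtom, realize_modelAtom, realize_and, realize_conj,
        realize_varEq]
      exact fun ⟨h₁, h₂, h₃⟩ => h.coherence P _ _ h₁ h₂ h₃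

/-- The reduct of a structure that satisfies the presentation theory is in the class. -/
theorem Presents.mem {M : E.starVocab.Str (Univ κ)} (h : E.Presents M) :
    @AEC.Mem L K (Univ κ) M.base := by
  obtain ⟨C, a, ha, hC⟩ := h.cover
  obtain ⟨e, -⟩ := (h.embeds C a hC).exists_equiv ha
  exact @AEC.mem_of_equiv L K (Univ κ) (Univ κ) C.1 M.base e (E.mem_modelType C)

/-- A model with universe `κ` is a strong submodel of itself, so its own chosen enumeration serves.
-/
theorem exists_surjective_enumeratesStrong (B : L.Structure (Univ κ))
    (hB : @AEC.Mem L K (Univ κ) B) :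
    ∃ C a, Function.Surjective a ∧ E.EnumeratesStrong B C a := by
  have c : #(Univ κ) = κ := Cardinal.mk_ord_toType κ
  refine ⟨⟨_, Univ κ, B, hB, c, rfl⟩, E.enum (Univ κ) hB c, (E.enum (Univ κ) hB c).surjective,
    (E.enumeratesStrong_iff B _ _).2 ⟨E.embedsVia_code (Univ κ) hB c, ⊤, K.refl _ hB, ?_⟩⟩
  rw [(E.enum (Univ κ) hB c).surjective.range_eq]
  rfl

/-- The canonical expansion of a model in the class satisfies the presentation theory. -/
theorem presents_expansion (B : L.Structure (Univ κ)) (hB : @AEC.Mem L K (Univ κ) B) :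
    E.Presents (E.expansion B) where
  embeds C a h := ((E.enumeratesStrong_iff B C a).1 h).1
  overlap _ _ _ h := ⟨h.1, h.2.1, fun i => (h.2.2 i _).2 rfl⟩
  cover := E.exists_surjective_enumeratesStrong B hB
  restrict P b h := ⟨h.comp_pair E P, h,
    fun _ _ => ((E.enumeratesStrong_iff B _ b).1 h).1.injective.eq_iff⟩
  coherence _ _ b ha hb hab := ⟨ha, hb, fun i _ =>
    (iff_of_eq (congrArg (· = _) (hab i))).trans
      ((E.enumeratesStrong_iff B _ b).1 hb).1.injective.eq_iff⟩

end Models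

end CompatibleEnum

/-! ### Formulas decided by the keys -/

section Decided

variable {X T : Type u}

/-- Each point has a class on which the truth value of `p` is constant. -/
def IsDecided {I : Type u} (key : I → X → T) (p : X → Prop) : Prop :=
  ∀ x, ∃ δ, ∀ y, key δ y = key δ x → (p y ↔ p x)

variable {I : Type u} {key : I → X → T}

theorem IsDecided.not {p : X → Prop} (h : IsDecided key p) : IsDecided key fun x => ¬ p x :=
  fun x => (h x).imp fun _ h y hy => not_congr (h y hy)

theorem isDecided_const [Nonempty I] (p : Prop) : IsDecided key fun _ => p :=
  fun _ => ⟨Classical.arbitrary _, fun _ _ => Iff.rfl⟩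

theorem IsDecided.isOpen {p : X → Prop} (h : IsDecided key p) :
    @IsOpen X (keyTopology key) {x | p x} :=
  keyTopology_isOpen key fun x hx => (h x).imp fun _ h y hy => (h y hy).2 hx

/-- Fewer than `cof I` deciding levels have a common upper bound, and agreement there implies
agreement at all of them. -/
theorem IsDecided.forall [LinearOrder I]
    (mono : Refines key)
    {ι : Type u} (hι : #ι < Order.cof I) {p : ι → X → Prop} (h : ∀ i, IsDecided key (p i)) :
    IsDecided key fun x => ∀ i, p i x := by
  intro x
  choose g hg using fun i => h i x
  obtain ⟨δ, hδ⟩ := exists_forall_lt_of_lt_cof g hι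
  exact ⟨δ, fun y hy => forall_congr' fun i => hg i y (mono (hδ i).le hy)⟩

theorem IsDecided.exists [LinearOrder I]
    (mono : Refines key)
    {ι : Type u} (hι : #ι < Order.cof I) {p : ι → X → Prop} (h : ∀ i, IsDecided key (p i)) :
    IsDecided key fun x => ∃ i, p i x := by
  simpa using (IsDecided.forall mono hι fun i => (h i).not).not

end Decided

theorem mk_iUnion_le_of_le {V ι : Type u} {κ : Cardinal.{u}} (h0 : ℵ₀ ≤ κ) (hι : #ι ≤ κ)
    {S : ι → Set V} (h : ∀ i, #(S i) ≤ κ) : #(⋃ i, S i) ≤ κ := by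
  refine Cardinal.mk_iUnion_le_sum_mk.trans ((Cardinal.sum_le_sum _ (fun _ => κ) h).trans ?_)
  rw [Cardinal.sum_const']
  exact (mul_le_mul_left hι κ).trans_eq (Cardinal.mul_eq_self h0)

section Tame

variable {τ : Vocab.{u}} {V X T A I : Type u}

/-- `φ` has at most `κ` free variables, and its truth at each tuple is decided by the keys. -/
def Tame (κ : Cardinal.{u}) (key : I → X → T) (str : X → τ.Str A) (φ : InfFormula τ V) : Prop :=
  #φ.freeVars ≤ κ ∧ ∀ s : V → A, IsDecided key fun x => φ.Realize (str x) s

/-- The keys determine the finitary part of a structure, and decide the infinitary relations. -/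
structure DecidesAtoms (key : I → X → T) (str : X → τ.Str A) : Prop where
  base : ∀ {δ x y}, key δ y = key δ x → (str y).base = (str x).base
  rel : ∀ R a, IsDecided key fun x => (str x).rel R a

variable {κ : Cardinal.{u}} {key : I → X → T} {str : X → τ.Str A}

theorem Tame.neg {φ : InfFormula τ V} (h : Tame κ key str φ) : Tame κ key str (neg φ) :=
  ⟨h.1, fun s => (h.2 s).not⟩

theorem tame_of_isAtomic [Nonempty I] (h0 : ℵ₀ ≤ κ) (hd : DecidesAtoms key str)
    (har : ∀ R, #(τ.arity R) ≤ κ) {φ : InfFormula τ V} (hφ : φ.IsAtomic) :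
    Tame κ key str φ := by
  have hfin : ∀ {S : Set V}, S.Finite → #S ≤ κ := fun h => h.lt_aleph0.le.trans h0
  cases φ with
  | eq t₁ t₂ =>
    refine ⟨hfin ((finite_termVars t₁).union (finite_termVars t₂)), fun s x => ?_⟩
    refine ⟨Classical.arbitrary _, fun y hy => ?_⟩
    simp only [Realize]
    rw [hd.base hy]
  | rel R ts =>
    refine ⟨hfin (Set.finite_iUnion fun i => finite_termVars (ts i)), fun s x => ?_⟩
    refine ⟨Classical.arbitrary _, fun y hy => ?_⟩
    simp only [Realize]
    rw [hd.base hy]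
  | infRel R ts =>
    refine ⟨mk_iUnion_le_of_le h0 (har R) fun i => hfin (finite_termVars (ts i)), fun s x => ?_⟩
    -- The terms are evaluated in `x` alone: keys fix the reduct, so every structure in the class
    -- gives them the same values.
    obtain ⟨δ, hδ⟩ := hd.rel R (fun i => @Term.realize _ _ (str x).base _ s (ts i)) x
    refine ⟨δ, fun y hy => ?_⟩
    simp only [Realize]
    rw [hd.base hy]
    exact hδ y hy
  | neg => exact hφ.elim
  | conj => exact hφ.elim
  | ex => exact hφ.elim

/-- Substitution amounts to changing the assignment by the value of `t`, which is constant on key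
classes because the reduct is. -/
theorem Tame.subst (h0 : ℵ₀ ≤ κ) (hd : DecidesAtoms key str) {φ : InfFormula τ V} (v : V)
    (t : τ.lang.Term V) (h : Tame κ key str φ) (hf : φ.FreeFor v t) :
    Tame κ key str (φ.subst v t) := by
  classical
  refine ⟨(Cardinal.mk_le_mk_of_subset (freeVars_subst v t φ)).trans ?_, fun s x => ?_⟩
  · refine (Cardinal.mk_union_le _ _).trans (Cardinal.add_le_of_le h0 h.1 ?_)
    exact (finite_termVars t).lt_aleph0.le.trans h0
  · obtain ⟨δ, hδ⟩ := h.2 (Function.update s v (@Term.realize _ _ (str x).base _ s t)) x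
    refine ⟨δ, fun y hy => ?_⟩
    beta_reduce
    rw [InfFormula.realize_subst _ _ _ _ hf, InfFormula.realize_subst _ _ _ _ hf, hd.base hy]
    exact hδ y hy

variable [LinearOrder I]

theorem Tame.conj (mono : Refines key) {ι : Type u} (hι : #ι < Order.cof I) {φ : ι → InfFormula τ V}
    (h : ∀ i, Tame κ key str (φ i)) (hc : #(conj φ).freeVars ≤ κ) :
    Tame κ key str (conj φ) :=
  ⟨hc, fun s => IsDecided.forall mono hι fun i => (h i).2 s⟩

/-- Quantifying one variable is a disjunction over the universe, which has fewer than `cof I`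
elements. Quantifying `κ` variables would need `#A ^ κ` disjuncts, so this argument does not extend
to them. -/
theorem Tame.ex (mono : Refines key) (hA : #A < Order.cof I) {φ : InfFormula τ V} (v : V) (h : Tame κ key str φ) :
    Tame κ key str (ex {v} φ) := by
  classical
  refine ⟨(Cardinal.mk_le_mk_of_subset Set.sdiff_subset).trans h.1, fun s => ?_⟩
  have : (fun x => (InfFormula.ex {v} φ).Realize (str x) s) =
      fun x => ∃ a : A, φ.Realize (str x) (Function.update s v a) := by
    funext x
    refine propext ⟨?_, fun ⟨a, ha⟩ => ⟨_, fun w hw => Function.update_of_ne hw _ _, ha⟩⟩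
    rintro ⟨r, hr, h⟩
    refine ⟨r v, ?_⟩
    rwa [show Function.update s v (r v) = r from funext fun w => ?_]
    by_cases e : w = v
    · subst e; simp
    · rw [Function.update_of_ne e, hr w e]
  rw [this]
  exact IsDecided.exists mono hA fun a => h.2 _

/-- The fragment of all hereditarily tame formulas. -/
theorem isFragment_tame {μ : Cardinal.{u}} [Nonempty I] (mono : Refines key) (h0 : ℵ₀ ≤ κ)
    (hd : DecidesAtoms key str) (har : ∀ R, #(τ.arity R) ≤ κ) (hA : #A < Order.cof I)
    (hμ : μ ≤ Order.cof I) :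
    IsFragment μ κ {φ : InfFormula τ V | φ.IsBounded μ κ ∧ Hereditarily (Tame κ key str) φ} :=
  isFragment_hereditarily h0 (fun _ h => h.1) (fun _ h => tame_of_isAtomic h0 hd har h)
    (fun _ v t h hf => h.subst h0 hd v t hf) (fun _ h => h.neg) (fun _ v h => h.ex mono hA v)
    (fun _ _ hι h hc => Tame.conj mono (hι.trans_le hμ) h hc)

end Tame

/-! ### Counting structures and instances -/

section Cardinality

variable {L : FirstOrder.Language.{u, u}} {K : AEC L} {κ : Cardinal.{u}}

/-- The instances of finitary function symbols in the universe `κ`. -/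
abbrev FunInstance (L : FirstOrder.Language.{u, u}) (κ : Cardinal.{u}) : Type u :=
  Σ p : (Σ n, L.Functions n), Fin p.1 → Univ κ

/-- The instances of finitary relation symbols in the universe `κ`. -/
abbrev RelInstance (L : FirstOrder.Language.{u, u}) (κ : Cardinal.{u}) : Type u :=
  Σ p : (Σ n, L.Relations n), Fin p.1 → Univ κ

theorem mk_sigma_le_of_le {ι : Type u} {c : Cardinal.{u}} (h0 : ℵ₀ ≤ c) (hι : #ι ≤ c)
    {S : ι → Type u} (h : ∀ i, #(S i) ≤ c) : #(Σ i, S i) ≤ c := by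
  rw [Cardinal.mk_sigma]
  refine (Cardinal.sum_le_sum _ (fun _ => c) h).trans ?_
  rw [Cardinal.sum_const']
  exact (mul_le_mul_left hι c).trans_eq (Cardinal.mul_eq_self h0)

theorem mk_fin_fun_le (h0 : ℵ₀ ≤ κ) (n : ℕ) : #(Fin n → Univ κ) ≤ κ := by
  have : #(Fin n → Univ κ) = κ ^ n := by simp
  exact this.trans_le (Cardinal.power_nat_le h0)

theorem mk_funInstance_le (h0 : ℵ₀ ≤ κ) (hL : L.card ≤ κ) : #(FunInstance L κ) ≤ κ :=
  mk_sigma_le_of_le h0 ((Cardinal.mk_le_of_injective Sum.inl_injective).trans hL)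
    fun p => mk_fin_fun_le h0 p.1

theorem mk_relInstance_le (h0 : ℵ₀ ≤ κ) (hL : L.card ≤ κ) : #(RelInstance L κ) ≤ κ :=
  mk_sigma_le_of_le h0 ((Cardinal.mk_le_of_injective Sum.inr_injective).trans hL)
    fun p => mk_fin_fun_le h0 p.1

/-- At most `κ` function values and `κ` truth values are to be chosen: `κ ^ κ * 2 ^ κ = 2 ^ κ`. -/
theorem mk_structure_le (h0 : ℵ₀ ≤ κ) (hL : L.card ≤ κ) : #(L.Structure (Univ κ)) ≤ 2 ^ κ := by
  let f : L.Structure (Univ κ) → (FunInstance L κ → Univ κ) × Set (RelInstance L κ) := fun B =>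
    (fun p => B.funMap p.1.2 p.2, {p | B.RelMap p.1.2 p.2})
  have hf : Function.Injective f := fun B B' h => structure_ext
    (fun f xs => congrFun (congrArg Prod.fst h) ⟨⟨_, f⟩, xs⟩)
    (fun R xs => Set.ext_iff.1 (congrArg Prod.snd h) ⟨⟨_, R⟩, xs⟩)
  refine (Cardinal.mk_le_of_injective hf).trans ?_
  rw [Cardinal.mk_prod, Cardinal.lift_id, Cardinal.lift_id, Cardinal.mk_set, ← Cardinal.power_def,
    Cardinal.mk_ord_toType]
  refine (mul_le_mul' (Cardinal.power_le_power_left (Cardinal.aleph0_pos.trans_le h0).ne'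
    (mk_funInstance_le h0 hL)) (Cardinal.power_le_power_left two_ne_zero
    (mk_relInstance_le h0 hL))).trans ?_
  rw [Cardinal.power_self_eq h0, Cardinal.mul_eq_self (h0.trans (Cardinal.cantor κ).le)]

namespace CompatibleEnum

variable (E : CompatibleEnum K κ)

theorem mk_modelType_le (h0 : ℵ₀ ≤ κ) (hL : L.card ≤ κ) : #E.ModelType ≤ 2 ^ κ :=
  (Cardinal.mk_subtype_le _).trans (mk_structure_le h0 hL)

theorem mk_univ_fun (h0 : ℵ₀ ≤ κ) : #(Univ κ → Univ κ) = 2 ^ κ := by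
  rw [← Cardinal.power_def, Cardinal.mk_ord_toType, Cardinal.power_self_eq h0]

theorem mk_pairType_le (h0 : ℵ₀ ≤ κ) (hL : L.card ≤ κ) : #E.PairType ≤ 2 ^ κ := by
  let f : E.PairType → E.ModelType × E.ModelType × (Univ κ → Univ κ) := fun P =>
    (P.sub, P.sup, P.π)
  have hf : Function.Injective f := fun P P' h => by
    cases P
    cases P'
    simp only [f, Prod.mk.injEq] at h
    obtain ⟨rfl, rfl, rfl⟩ := h
    rfl
  have hμ : ℵ₀ ≤ (2 : Cardinal.{u}) ^ κ := h0.trans (Cardinal.cantor κ).le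
  refine (Cardinal.mk_le_of_injective hf).trans ?_
  simp only [Cardinal.mk_prod, Cardinal.lift_id]
  rw [mk_univ_fun h0]
  exact (mul_le_mul' (E.mk_modelType_le h0 hL) (mul_le_mul_left (E.mk_modelType_le h0 hL) _)).trans_eq
    (by rw [Cardinal.mul_eq_self hμ, Cardinal.mul_eq_self hμ])

theorem mk_arity_le (h0 : ℵ₀ ≤ κ) (R : E.starVocab.Sym) : #(E.starVocab.arity R) ≤ κ := by
  obtain C | P := R
  · exact (Cardinal.mk_ord_toType κ).le
  · change #(Univ κ ⊕ Univ κ) ≤ κ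
    rw [Cardinal.mk_sum, Cardinal.lift_id, Cardinal.mk_ord_toType, Cardinal.add_eq_self h0]

/-- The instances of infinitary relation symbols in the universe `κ`. -/
abbrev Instance : Type u := Σ R : E.starVocab.Sym, (E.starVocab.arity R → Univ κ)

/-- At most `2 ^ κ` symbols, each with at most `κ ^ κ = 2 ^ κ` tuples; hence instances can be
indexed injectively by `μ`. -/
theorem mk_instance_le (h0 : ℵ₀ ≤ κ) (hL : L.card ≤ κ) : #E.Instance ≤ 2 ^ κ := by
  have hμ : ℵ₀ ≤ (2 : Cardinal.{u}) ^ κ := h0.trans (Cardinal.cantor κ).le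
  refine mk_sigma_le_of_le hμ ?_ fun R => ?_
  · change #(E.ModelType ⊕ E.PairType) ≤ _
    rw [Cardinal.mk_sum, Cardinal.lift_id, Cardinal.lift_id]
    exact Cardinal.add_le_of_le hμ (E.mk_modelType_le h0 hL) (E.mk_pairType_le h0 hL)
  · rw [← Cardinal.power_def, Cardinal.mk_ord_toType, ← Cardinal.power_self_eq h0]
    exact Cardinal.power_le_power_left (Cardinal.aleph0_pos.trans_le h0).ne' (E.mk_arity_le h0 R)

end CompatibleEnum

end Cardinality

/-! ### The keys of models of the presentation theory -/

namespace CompatibleEnum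

section Key

variable {L : FirstOrder.Language.{u, u}} {K : AEC L} {κ μ : Cardinal.{u}} (E : CompatibleEnum K κ)
  (index : E.Instance → Univ μ)

/-- The indices of the true instances `R_[M](a)` in which `a` enumerates the universe. -/
def coverIndices (M : E.starVocab.Str (Univ κ)) : Set (Univ μ) :=
  {δ | ∃ C a, Function.Surjective a ∧ E.RelModel M C a ∧ index ⟨Sum.inl C, a⟩ = δ}

theorem Presents.coverIndices_nonempty {M : E.starVocab.Str (Univ κ)} (h : E.Presents M) :
    (E.coverIndices index M).Nonempty := by
  obtain ⟨C, a, ha, hC⟩ := h.cover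
  exact ⟨_, C, a, ha, hC, rfl⟩

/-- The least index of a true instance `R_[M](a)` in which `a` enumerates the universe. -/
noncomputable def firstCover (M : E.starVocab.Str (Univ κ)) (h : E.Presents M) : Univ μ :=
  (wellFounded_lt (α := Univ μ)).min _ (h.coverIndices_nonempty E index)

/-- The structures satisfy the same instances of index below `δ`. -/
def AgreeBelow (δ : Univ μ) (M N : E.starVocab.Str (Univ κ)) : Prop :=
  ∀ j : E.Instance, index j < δ → (M.rel j.1 j.2 ↔ N.rel j.1 j.2)

variable {index}

theorem AgreeBelow.symm {δ : Univ μ} {M N : E.starVocab.Str (Univ κ)}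
    (h : E.AgreeBelow index δ M N) : E.AgreeBelow index δ N M := fun j hj => (h j hj).symm

/-- A first cover of index below `δ` is seen by both structures, so neither can have a smaller one
than the other. Thus the cover component of the key is determined by sufficiently many instances. -/
theorem AgreeBelow.firstCover_eq {δ : Univ μ} {M N : E.starVocab.Str (Univ κ)}
    (h : E.AgreeBelow index δ M N) (hM : E.Presents M) (hN : E.Presents N)
    (hδ : E.firstCover index M hM < δ) : E.firstCover index M hM = E.firstCover index N hN := by
  have wf := wellFounded_lt (α := Univ μ)
  have le : ∀ {M N : E.starVocab.Str (Univ κ)} (_ : E.AgreeBelow index δ M N)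
      (hM : E.Presents M) (hN : E.Presents N), E.firstCover index M hM < δ →
      E.firstCover index N hN ≤ E.firstCover index M hM := by
    intro M N h hM hN hδ
    obtain ⟨C, a, ha, hC, hi⟩ := wf.min_mem _ (hM.coverIndices_nonempty E index)
    exact not_lt.1 (wf.not_lt_min (E.coverIndices index N)
      ⟨C, a, ha, (h ⟨Sum.inl C, a⟩ (hi.trans_lt hδ)).1 hC, hi⟩)
  have h₁ := le h hM hN hδ
  exact (le (h.symm E) hN hM (h₁.trans_lt hδ)).antisymm h₁

variable (index)

variable {X : Type u} (str : X → E.starVocab.Str (Univ κ)) (hX : ∀ M, E.Presents (str M))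

/-- The key of level `δ`: the reduct, the index of the first instance that covers the universe, and
the indices below `δ` of the true instances. -/
noncomputable def key (δ : Univ μ) (M : X) :
    L.Structure (Univ κ) × Univ μ × Set (Univ μ) :=
  ((str M).base, E.firstCover index (str M) (hX M),
    {η | η < δ ∧ ∃ j : E.Instance, index j = η ∧ (str M).rel j.1 j.2})

variable {index}

theorem key_eq_iff (hi : Function.Injective index) {δ : Univ μ} {M N : X} :
    E.key index str hX δ M = E.key index str hX δ N ↔ (str M).base = (str N).base ∧
      E.firstCover index (str M) (hX M) = E.firstCover index (str N) (hX N) ∧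
      E.AgreeBelow index δ (str M) (str N) := by
  refine Prod.ext_iff.trans (and_congr Iff.rfl
    (Prod.ext_iff.trans (and_congr Iff.rfl ⟨fun h j hj => ?_, fun h => ?_⟩)))
  · have e : ∀ M, index j ∈ (E.key index str hX δ M).2.2 ↔ (str M).rel j.1 j.2 := fun M =>
      ⟨fun ⟨_, k, hk, h⟩ => hi hk ▸ h, fun h => ⟨hj, j, rfl, h⟩⟩
    exact (e M).symm.trans ((Set.ext_iff.1 h (index j)).trans (e N))
  · ext η
    refine and_congr_right fun hη => exists_congr fun j => and_congr_right fun hj => ?_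
    exact h j (hj.trans_lt hη)

theorem refines_key (hi : Function.Injective index) : Refines (E.key index str hX) := by
  intro δ δ' M N hle h
  rw [key_eq_iff E str hX hi] at h ⊢
  exact ⟨h.1, h.2.1, fun j hj => h.2.2 j (hj.trans_le hle)⟩

theorem decidesAtoms_key [NoMaxOrder (Univ μ)] (hi : Function.Injective index) :
    DecidesAtoms (E.key index str hX) str where
  base h := ((key_eq_iff E str hX hi).1 h).1
  rel R a M := by
    obtain ⟨δ, hδ⟩ := exists_gt (index ⟨R, a⟩)
    exact ⟨δ, fun N hN => ((key_eq_iff E str hX hi).1 hN).2.2 ⟨R, a⟩ hδ⟩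

theorem key_separating [NoMaxOrder (Univ μ)] [Nonempty (Univ μ)] (hi : Function.Injective index)
    (hstr : Function.Injective str) (M N : X)
    (h : ∀ δ, E.key index str hX δ M = E.key index str hX δ N) : M = N := by
  have hb : (str M).base = (str N).base :=
    ((key_eq_iff E str hX hi).1 (h (Classical.arbitrary _))).1
  have hr : (str M).rel = (str N).rel := by
    funext R a
    obtain ⟨δ, hδ⟩ := exists_gt (index ⟨R, a⟩)
    exact propext (((key_eq_iff E str hX hi).1 (h δ)).2.2 ⟨R, a⟩ hδ)
  apply hstr
  cases h₁ : str M
  cases h₂ : str N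
  simp_all

/-- The reduct and the cover index have at most `μ` values each, and the last component is a subset
of `δ`, with `2 ^ |δ| ≤ μ ^ |δ| ≤ μ^{<μ} = μ`. -/
theorem mk_range_key_le (h0 : ℵ₀ ≤ κ) (hL : L.card ≤ κ) (hμ : μ = 2 ^ κ) (hpow : μ ^< μ = μ)
    (δ : Univ μ) : #(Set.range (E.key index str hX δ)) ≤ μ := by
  have hμ0 : ℵ₀ ≤ μ := hμ ▸ h0.trans (Cardinal.cantor κ).le
  let f : Set.range (E.key index str hX δ) →
      L.Structure (Univ κ) × Univ μ × 𝒫 (Set.Iio δ) := fun t =>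
    (t.1.1, t.1.2.1, ⟨t.1.2.2, by obtain ⟨_, M, rfl⟩ := t; exact fun _ h => h.1⟩)
  have hf : Function.Injective f := by
    rintro ⟨⟨_, _, _⟩, _⟩ ⟨⟨_, _, _⟩, _⟩ h
    simpa [f] using h
  have h2 : (2 : Cardinal.{u}) ^ #(Set.Iio δ) ≤ μ :=
    (Cardinal.power_le_power_right ((Cardinal.ofNat_lt_aleph0 (n := 2)).le.trans hμ0)).trans
      ((Cardinal.le_powerlt μ (mk_Iio_univ_lt δ)).trans_eq hpow)
  refine (Cardinal.mk_le_of_injective hf).trans ?_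
  rw [Cardinal.mk_prod, Cardinal.mk_prod, Cardinal.mk_powerset, Cardinal.mk_ord_toType]
  simp only [Cardinal.lift_id]
  exact (mul_le_mul' ((mk_structure_le h0 hL).trans_eq hμ.symm) (mul_le_mul_right h2 μ)).trans_eq
    (by rw [Cardinal.mul_eq_self hμ0, Cardinal.mul_eq_self hμ0])

/-- A sequence of structures that stabilizes at each level converges to a structure which again
satisfies the presentation theory. -/
theorem exists_limit [NoMaxOrder (Univ μ)] [Nonempty (Univ μ)] (hi : Function.Injective index)
    (xs : Univ μ → X)
    (hxs : ∀ δ, ∃ α, ∀ β γ, α ≤ β → α ≤ γ →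
      E.key index str hX δ (xs β) = E.key index str hX δ (xs γ)) :
    ∃ (N : E.starVocab.Str (Univ κ)) (hN : E.Presents N), ∀ δ, ∃ α, ∀ β, α ≤ β →
      (str (xs β)).base = N.base ∧
      E.firstCover index (str (xs β)) (hX _) = E.firstCover index N hN ∧
      E.AgreeBelow index δ (str (xs β)) N := by
  simp only [key_eq_iff E str hX hi] at hxs
  choose α hα using hxs
  choose next hnext using fun δ : Univ μ => exists_gt δ
  let δ₀ : Univ μ := Classical.arbitrary _
  -- The limit reads each instance at a stage where a level strictly above its index has stabilized;
  -- any stabilized stage gives the reduct.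
  let N : E.starVocab.Str (Univ κ) :=
    ⟨(str (xs (α δ₀))).base, fun R a => (str (xs (α (next (index ⟨R, a⟩))))).rel R a⟩
  have agree : ∀ δ, ∃ ξ, ∀ β, ξ ≤ β → (str (xs β)).base = N.base ∧
      E.firstCover index (str (xs β)) (hX _) = E.firstCover index (str (xs (α δ₀))) (hX _) ∧
      E.AgreeBelow index δ (str (xs β)) N := by
    intro δ
    refine ⟨max (α δ₀) (α δ), fun β hβ => ?_⟩
    have h₀ := hα δ₀ β (α δ₀) ((le_max_left _ _).trans hβ) le_rfl
    refine ⟨h₀.1, h₀.2.1, fun j hj => ?_⟩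
    have h₁ := (hα δ β (max β (α (next (index j)))) ((le_max_right _ _).trans hβ)
      (((le_max_right _ _).trans hβ).trans (le_max_left _ _))).2.2 j hj
    have h₂ := (hα (next (index j)) (max β (α (next (index j)))) (α (next (index j)))
      (le_max_right _ _) le_rfl).2.2 j (hnext _)
    exact h₁.trans h₂
  -- Below any prescribed index, `N` looks like an actual model with the same reduct and with the
  -- stable cover index.
  have approx : ∀ δ, ∃ M : X, (str M).base = N.base ∧
      E.firstCover index (str M) (hX M) = E.firstCover index (str (xs (α δ₀))) (hX _) ∧
      E.AgreeBelow index δ (str M) N := fun δ => by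
    obtain ⟨ξ, hξ⟩ := agree δ
    exact ⟨_, hξ ξ le_rfl⟩
  have hN : E.Presents N := by
    refine ⟨fun C a h => ?_, fun P a b h => ?_, ?_, fun P b h => ?_, fun P a b ha hb hab => ?_⟩
    · obtain ⟨M, hb, -, hM⟩ := approx (next (index ⟨Sum.inl C, a⟩))
      have := (hX M).embeds C a ((hM ⟨Sum.inl C, a⟩ (hnext _)).2 h)
      rwa [hb] at this
    · let j₁ : E.Instance := ⟨Sum.inr P, (Sum.elim a b : Univ κ ⊕ Univ κ → Univ κ)⟩
      let j₂ : E.Instance := ⟨Sum.inl P.sub, a⟩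
      let j₃ : E.Instance := ⟨Sum.inl P.sup, b⟩
      obtain ⟨M, -, -, hM⟩ := approx (next (max (index j₁) (max (index j₂) (index j₃))))
      have := (hX M).overlap P a b ((hM j₁ ((le_max_left _ _).trans_lt (hnext _))).2 h)
      exact ⟨(hM j₂ (((le_max_left _ _).trans (le_max_right _ _)).trans_lt (hnext _))).1 this.1,
        (hM j₃ (((le_max_right _ _).trans (le_max_right _ _)).trans_lt (hnext _))).1 this.2.1,
        this.2.2⟩
    -- Agreement past the stable cover index transfers the covering instance to `N`; without
    -- stability that instance could have escaped.
    · obtain ⟨M, -, hfc, hM⟩ := approx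
        (next (E.firstCover index (str (xs (α δ₀))) (hX _)))
      obtain ⟨C, a, ha, hC, hi'⟩ := (wellFounded_lt (α := Univ μ)).min_mem _
        ((hX M).coverIndices_nonempty E index)
      exact ⟨C, a, ha, (hM ⟨Sum.inl C, a⟩ ((hi'.trans hfc).trans_lt (hnext _))).1 hC⟩
    · let j₁ : E.Instance :=
        ⟨Sum.inr P, (Sum.elim (fun i => b (P.π i)) b : Univ κ ⊕ Univ κ → Univ κ)⟩
      let j₂ : E.Instance := ⟨Sum.inl P.sup, b⟩
      obtain ⟨M, -, -, hM⟩ := approx (next (max (index j₁) (index j₂)))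
      exact (hM j₁ ((le_max_left _ _).trans_lt (hnext _))).1 ((hX M).restrict P b
        ((hM j₂ ((le_max_right _ _).trans_lt (hnext _))).2 h))
    · let j₁ : E.Instance := ⟨Sum.inr P, (Sum.elim a b : Univ κ ⊕ Univ κ → Univ κ)⟩
      let j₂ : E.Instance := ⟨Sum.inl P.sub, a⟩
      let j₃ : E.Instance := ⟨Sum.inl P.sup, b⟩
      obtain ⟨M, -, -, hM⟩ := approx (next (max (index j₁) (max (index j₂) (index j₃))))
      exact (hM j₁ ((le_max_left _ _).trans_lt (hnext _))).1 ((hX M).coherence P a b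
        ((hM j₂ (((le_max_left _ _).trans (le_max_right _ _)).trans_lt (hnext _))).2 ha)
        ((hM j₃ (((le_max_right _ _).trans (le_max_right _ _)).trans_lt (hnext _))).2 hb) hab)
  refine ⟨N, hN, fun δ => ?_⟩
  obtain ⟨M, -, hfc, hM⟩ := approx (next (E.firstCover index (str (xs (α δ₀))) (hX _)))
  have hfN := hM.firstCover_eq E (hX M) hN (hfc.trans_lt (hnext _))
  obtain ⟨ξ, hξ⟩ := agree δ
  exact ⟨ξ, fun β hβ => ⟨(hξ β hβ).1, (hξ β hβ).2.1.trans (hfc.symm.trans hfN), (hξ β hβ).2.2⟩⟩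

/-- Whether some predicate `R_[M]` holds of a given tuple is decided by the keys, as the reduct
leaves only one candidate for `[M]`. -/
theorem isDecided_exists_relModel [NoMaxOrder (Univ μ)] [Nonempty (Univ μ)]
    (hi : Function.Injective index) (a : Univ κ → Univ κ) :
    IsDecided (E.key index str hX) fun M => ∃ C, E.RelModel (str M) C a := by
  intro M
  -- The search runs over all structures with the reduct of `M`. If one realizes some type at `a`,
  -- that type is the sole candidate and a single instance decides; otherwise the statement is false
  -- on the whole class.
  by_cases h : ∃ N C, (str N).base = (str M).base ∧ E.RelModel (str N) C a
  · obtain ⟨N, C, hb, hC⟩ := h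
    have huniq : ∀ N', (str N').base = (str M).base → ∀ C', E.RelModel (str N') C' a → C' = C := by
      intro N' hb' C' hC'
      have h₁ := (hX N).embeds C a hC
      have h₂ := (hX N').embeds C' a hC'
      rw [hb] at h₁
      rw [hb'] at h₂
      exact Subtype.ext (h₂.source_unique h₁)
    obtain ⟨δ, hδ⟩ := (E.decidesAtoms_key str hX hi).rel (Sum.inl C) a M
    refine ⟨δ, fun N' hN' => ?_⟩
    have hb' := ((key_eq_iff E str hX hi).1 hN').1
    constructor
    · rintro ⟨C', hC'⟩
      exact ⟨C, (hδ N' hN').1 (huniq N' hb' C' hC' ▸ hC')⟩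
    · rintro ⟨C', hC'⟩
      exact ⟨C, (hδ N' hN').2 (huniq M rfl C' hC' ▸ hC')⟩
  · refine ⟨Classical.arbitrary _, fun N hN => ?_⟩
    have hb := ((key_eq_iff E str hX hi).1 hN).1
    exact ⟨fun ⟨C, hC⟩ => (h ⟨N, C, hb, hC⟩).elim, fun ⟨C, hC⟩ => (h ⟨M, C, rfl, hC⟩).elim⟩

end Key

end CompatibleEnum

/-! ### The presentation theory lies in the tame fragment -/

section BoundedTame

variable {τ : Vocab.{u}} {V X T A I : Type u} {μ κ : Cardinal.{u}}

/-- The members of the fragment of hereditarily tame formulas. -/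
def BoundedTame (μ κ : Cardinal.{u}) (key : I → X → T) (str : X → τ.Str A) (φ : InfFormula τ V) :
    Prop :=
  φ.IsBounded μ κ ∧ Hereditarily (Tame κ key str) φ

variable {key : I → X → T} {str : X → τ.Str A} {φ ψ : InfFormula τ V}

theorem BoundedTame.neg (h : BoundedTame μ κ key str φ) : BoundedTame μ κ key str (neg φ) :=
  ⟨h.1, hereditarily_neg h.2 h.2.self.neg⟩

/-- Quantification is harmless if it results in a formula of constant truth value. -/
theorem BoundedTame.ex [Nonempty I] {W : Set V} (hW : #W ≤ κ) (h : BoundedTame μ κ key str φ)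
    (p : Prop) (hv : ∀ x s, (ex W φ).Realize (str x) s ↔ p) :
    BoundedTame μ κ key str (ex W φ) := by
  refine ⟨⟨hW, h.1⟩, hereditarily_ex h.2
    ⟨(Cardinal.mk_le_mk_of_subset Set.sdiff_subset).trans h.2.self.1, fun s => ?_⟩⟩
  simp only [hv]
  exact isDecided_const p

theorem BoundedTame.all [Nonempty I] {W : Set V} (hW : #W ≤ κ) (h : BoundedTame μ κ key str φ)
    (hv : ∀ x s, (all W φ).Realize (str x) s) : BoundedTame μ κ key str (all W φ) :=
  (h.neg.ex hW False fun x s => iff_false_intro (hv x s)).neg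

variable [LinearOrder I] {ι : Type u} {Φ : ι → InfFormula τ V}

theorem boundedTame_conj (mono : Refines key) (h0 : ℵ₀ ≤ κ) (hI : κ < Order.cof I) (hμ : κ ≤ μ)
    (hι : #ι ≤ κ) (h : ∀ i, BoundedTame μ κ key str (Φ i)) :
    BoundedTame μ κ key str (conj Φ) :=
  ⟨⟨hι.trans hμ, fun i => (h i).1⟩, hereditarily_conj (fun i => (h i).2)
    (Tame.conj mono (hι.trans_lt hI) (fun i => (h i).2.self)
      (mk_iUnion_le_of_le h0 hι fun i => (h i).2.self.1))⟩

theorem boundedTame_disj (mono : Refines key) (h0 : ℵ₀ ≤ κ) (hI : κ < Order.cof I) (hμ : κ ≤ μ)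
    (hι : #ι ≤ κ) (h : ∀ i, BoundedTame μ κ key str (Φ i)) :
    BoundedTame μ κ key str (disj Φ) :=
  (boundedTame_conj mono h0 hI hμ hι fun i => (h i).neg).neg

theorem boundedTame_and (mono : Refines key) (h0 : ℵ₀ ≤ κ) (hI : κ < Order.cof I) (hμ : κ ≤ μ)
    (h₁ : BoundedTame μ κ key str φ) (h₂ : BoundedTame μ κ key str ψ) :
    BoundedTame μ κ key str (and φ ψ) := by
  refine boundedTame_conj mono h0 hI hμ ((Cardinal.lt_aleph0_of_finite _).le.trans h0) ?_
  rintro ⟨_ | _⟩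
  · exact h₂
  · exact h₁

theorem boundedTame_imp (mono : Refines key) (h0 : ℵ₀ ≤ κ) (hI : κ < Order.cof I) (hμ : κ ≤ μ)
    (h₁ : BoundedTame μ κ key str φ) (h₂ : BoundedTame μ κ key str ψ) :
    BoundedTame μ κ key str (imp φ ψ) :=
  (boundedTame_and mono h0 hI hμ h₁ h₂.neg).neg

end BoundedTame

namespace CompatibleEnum

variable {L : FirstOrder.Language.{u, u}} {K : AEC L} {κ μ : Cardinal.{u}} (E : CompatibleEnum K κ)
  {V : Type u}

theorem mk_range_le {x : Univ κ → V} : #(Set.range x) ≤ κ :=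
  Cardinal.mk_range_le.trans_eq (Cardinal.mk_ord_toType κ)

/-- The presentation theory consists of hereditarily tame formulas. -/
theorem theory_subset_boundedTame {X T I : Type u} [LinearOrder I] [Nonempty I] {key : I → X → T}
    {str : X → E.starVocab.Str (Univ κ)} {x y : Univ κ → V} (hX : ∀ M, IsModel (str M) (E.Theory x y))
    (mono : Refines key) (hd : DecidesAtoms key str)
    (hex : ∀ a, IsDecided key fun M => ∃ C, E.RelModel (str M) C a)
    (h0 : ℵ₀ ≤ κ) (hI : κ < Order.cof I) (hμ : κ ≤ μ) (hm : #E.ModelType ≤ μ) :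
    E.Theory x y ⊆ {φ | BoundedTame μ κ key str φ} := by
  have atom : ∀ {φ : InfFormula E.starVocab V}, φ.IsAtomic → BoundedTame μ κ key str φ := by
    intro φ hφ
    refine ⟨by cases φ <;> trivial, hereditarily_of_isAtomic hφ ?_⟩
    exact tame_of_isAtomic h0 hd (E.mk_arity_le h0) hφ
  have hu : #(Univ κ) ≤ κ := (Cardinal.mk_ord_toType κ).le
  have hxy : #(Set.range x ∪ Set.range y : Set V) ≤ κ :=
    (Cardinal.mk_union_le _ _).trans (Cardinal.add_le_of_le h0 mk_range_le mk_range_le)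
  have imp : ∀ {φ ψ : InfFormula E.starVocab V}, BoundedTame μ κ key str φ →
      BoundedTame μ κ key str ψ → BoundedTame μ κ key str (imp φ ψ) :=
    boundedTame_imp mono h0 hI hμ
  have and : ∀ {φ ψ : InfFormula E.starVocab V}, BoundedTame μ κ key str φ →
      BoundedTame μ κ key str ψ → BoundedTame μ κ key str (and φ ψ) :=
    boundedTame_and mono h0 hI hμ
  have model : ∀ C (z : Univ κ → V), BoundedTame μ κ key str (E.modelAtom C z) :=
    fun C z => atom (by trivial)
  -- This disjunction may have `μ` members, beyond the closure of tameness under small conjunctions;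
  -- `hex` decides it directly.
  have disjModel : BoundedTame μ κ key str (disj fun C => E.modelAtom C y) := by
    refine BoundedTame.neg ⟨⟨hm, fun C => (model C y).neg.1⟩,
      hereditarily_conj (fun C => (model C y).neg.2) ⟨?_, fun s => ?_⟩⟩
    · refine (Cardinal.mk_le_mk_of_subset ?_).trans (mk_range_le (x := y))
      refine Set.iUnion_subset fun C => Set.iUnion_subset fun i => ?_
      exact Set.singleton_subset_iff.2 ⟨i, rfl⟩
    · have := (hex (s ∘ y)).not
      simp only [not_exists] at this
      exact this
  intro φ hφ
  -- Truth in every structure considered makes the long universal quantifiers harmless: the axioms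
  -- have constant truth value.
  have valid := fun M => hX M φ hφ
  cases hφ with
  | eq C t₁ t₂ h => exact BoundedTame.all mk_range_le (imp (model C x) (atom (by trivial))) valid
  | ne C t₁ t₂ h =>
    exact BoundedTame.all mk_range_le (imp (model C x) (BoundedTame.neg (atom (by trivial)))) valid
  | rel C n R ts h => exact BoundedTame.all mk_range_le (imp (model C x) (atom (by trivial))) valid
  | not_rel C n R ts h =>
    exact BoundedTame.all mk_range_le (imp (model C x) (BoundedTame.neg (atom (by trivial)))) valid
  | overlap P =>
    exact BoundedTame.all hxy (imp (atom (by trivial)) (and (model _ _) (and (model _ _)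
      (boundedTame_conj mono h0 hI hμ hu fun i => atom (by trivial))))) valid
  | cover =>
    -- The inner existential must be tame too, as a subformula; validity of its universal closure
    -- makes it constantly true.
    refine (BoundedTame.ex mk_range_le (and disjModel (boundedTame_conj mono h0 hI hμ hu fun i =>
      boundedTame_disj mono h0 hI hμ hu fun j => atom (by trivial))) True fun M s =>
      iff_true_intro ?_).all mk_range_le valid
    exact (forall_realize_all _ _ _).1 (valid M) s
  | restrict P => exact BoundedTame.all mk_range_le (imp (model _ _) (atom (by trivial))) valid
  | coherence P =>
    exact BoundedTame.all hxy (imp (and (model _ _) (and (model _ _)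
      (boundedTame_conj mono h0 hI hμ hu fun i => atom (by trivial)))) (atom (by trivial))) valid

/-- The formula that describes, with the variables `x`, the finitary part of a structure and its
infinitary relations with index below `δ`. -/
noncomputable def diagram (index : E.Instance → Univ μ) (x : Univ κ → V) (δ : Univ μ)
    (M : E.starVocab.Str (Univ κ)) : InfFormula E.starVocab V :=
  open Classical in
  InfFormula.conj (ι := FunInstance L κ ⊕ RelInstance L κ ⊕ {j : E.Instance // index j < δ}) fun
    | .inl p => InfFormula.eq (τ := E.starVocab)
        (Term.func (L := L) p.1.2 fun i => Term.var (x (p.2 i)))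
        (Term.var (x (@Structure.funMap L _ M.base _ p.1.2 p.2)))
    | .inr (.inl p) =>
        let φ := InfFormula.rel (τ := E.starVocab) p.1.2 fun i => Term.var (x (p.2 i))
        if @Structure.RelMap L _ M.base _ p.1.2 p.2 then φ else InfFormula.neg φ
    | .inr (.inr j) =>
        let φ := InfFormula.infRel (τ := E.starVocab) j.1.1 fun i => Term.var (x (j.1.2 i))
        if M.rel j.1.1 j.1.2 then φ else InfFormula.neg φ

variable (index : E.Instance → Univ μ) (x : Univ κ → V) (δ : Univ μ)

theorem realize_diagram (M N : E.starVocab.Str (Univ κ)) (s : V → Univ κ) (hs : ∀ i, s (x i) = i) :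
    (E.diagram index x δ M).Realize N s ↔ N.base = M.base ∧ E.AgreeBelow index δ N M := by
  classical
  have hite : ∀ (p : Prop) [Decidable p] (φ : InfFormula E.starVocab V),
      (if p then φ else InfFormula.neg φ).Realize N s ↔ (φ.Realize N s ↔ p) := by
    intro p _ φ
    split_ifs with h <;> simp [h]
  have hf : ∀ p : FunInstance L κ, (InfFormula.eq (τ := E.starVocab)
        (Term.func (L := L) p.1.2 fun i => Term.var (x (p.2 i)))
        (Term.var (x (@Structure.funMap L _ M.base _ p.1.2 p.2)))).Realize N s ↔
      @Structure.funMap L _ N.base _ p.1.2 p.2 = @Structure.funMap L _ M.base _ p.1.2 p.2 := by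
    intro p
    change @Structure.funMap L _ N.base _ p.1.2 (fun i => s (x (p.2 i))) = s (x _) ↔ _
    simp only [hs]
  have hr : ∀ p : RelInstance L κ, (InfFormula.rel (τ := E.starVocab) p.1.2
        fun i => Term.var (x (p.2 i))).Realize N s ↔ @Structure.RelMap L _ N.base _ p.1.2 p.2 := by
    intro p
    change @Structure.RelMap L _ N.base _ p.1.2 (fun i => s (x (p.2 i))) ↔ _
    simp only [hs]
  have hj : ∀ j : E.Instance, (InfFormula.infRel (τ := E.starVocab) j.1
        fun i => Term.var (x (j.2 i))).Realize N s ↔ N.rel j.1 j.2 := by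
    intro j
    change N.rel j.1 (fun i => s (x (j.2 i))) ↔ _
    simp only [hs]
  rw [diagram, realize_conj]
  constructor
  · intro h
    refine ⟨structure_ext (L := L) (fun f xs => ?_) fun R xs => ?_, fun j hδ => ?_⟩
    · exact (hf ⟨⟨_, f⟩, xs⟩).1 (h (.inl ⟨⟨_, f⟩, xs⟩))
    · exact (hr ⟨⟨_, R⟩, xs⟩).symm.trans ((hite _ _).1 (h (.inr (.inl ⟨⟨_, R⟩, xs⟩))))
    · exact (hj j).symm.trans ((hite _ _).1 (h (.inr (.inr ⟨j, hδ⟩))))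
  · rintro ⟨hb, ha⟩ (p | p | j)
    · exact (hf p).2 (by rw [hb])
    · exact (hite _ _).2 ((hr p).trans (by rw [hb]))
    · exact (hite _ _).2 ((hj j.1).trans (ha j.1 j.2))

/-- There are at most `κ + κ + |δ| < μ` literals, all with free variables among the `κ` entries of
`x`, so every fragment contains the conjunction. -/
theorem diagram_mem {F : Set (InfFormula E.starVocab V)} (hF : IsFragment μ κ F) (h0 : ℵ₀ ≤ κ)
    (hL : L.card ≤ κ) (hμ : κ < μ) (hi : Function.Injective index) (M : E.starVocab.Str (Univ κ)) :
    E.diagram index x δ M ∈ F := by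
  classical
  have hite : ∀ (p : Prop) [Decidable p] (φ : InfFormula E.starVocab V), φ ∈ F →
      (if p then φ else InfFormula.neg φ) ∈ F := by
    intro p _ φ h
    split_ifs
    exacts [h, hF.neg φ h]
  have hfv : ∀ (p : Prop) [Decidable p] (φ : InfFormula E.starVocab V),
      (if p then φ else InfFormula.neg φ).freeVars = φ.freeVars := by
    intro p _ φ
    split_ifs <;> rfl
  have hμ0 : ℵ₀ ≤ μ := h0.trans hμ.le
  refine hF.conj _ _ ?_ ?_ ?_
  · rw [Cardinal.mk_sum, Cardinal.mk_sum]
    simp only [Cardinal.lift_id]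
    refine Cardinal.add_lt_of_lt hμ0 ((mk_funInstance_le h0 hL).trans_lt hμ)
      (Cardinal.add_lt_of_lt hμ0 ((mk_relInstance_le h0 hL).trans_lt hμ) ?_)
    have hinj : Function.Injective fun j : {j : E.Instance // index j < δ} =>
        (⟨index j.1, j.2⟩ : Set.Iio δ) := fun j k h => Subtype.ext (hi (congrArg Subtype.val h))
    exact (Cardinal.mk_le_of_injective hinj).trans_lt (mk_Iio_univ_lt δ)
  · rintro (p | p | j)
    · exact hF.atomic _ trivial
    · exact hite _ _ (hF.atomic _ trivial)
    · exact hite _ _ (hF.atomic _ trivial)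
  · refine (Cardinal.mk_le_mk_of_subset ?_).trans (mk_range_le (x := x))
    refine Set.iUnion_subset ?_
    rintro (p | p | j)
    · refine Set.union_subset (Set.iUnion_subset fun i => ?_) ?_ <;>
        exact Set.singleton_subset_iff.2 ⟨_, rfl⟩
    · refine (hfv _ _).trans_subset (Set.iUnion_subset fun i => ?_)
      exact Set.singleton_subset_iff.2 ⟨_, rfl⟩
    · refine (hfv _ _).trans_subset (Set.iUnion_subset fun i => ?_)
      exact Set.singleton_subset_iff.2 ⟨_, rfl⟩

/-- On the structures considered, the topology of a fragment is that of the keys. -/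
theorem induced_fragmentTopology_eq {X : Type u} {F : Set (InfFormula E.starVocab V)}
    (hF : IsFragment μ κ F) (h0 : ℵ₀ ≤ κ) (hL : L.card ≤ κ) (hμ : κ < μ)
    (hi : Function.Injective index) [NoMaxOrder (Univ μ)]
    (str : X → E.starVocab.Str (Univ κ)) (hX : ∀ M, E.Presents (str M))
    (hx : Function.Injective x)
    (hT : ∀ φ ∈ F, Tame κ (E.key index str hX) str φ) :
    (fragmentTopology F (Univ κ)).induced str = keyTopology (E.key index str hX) := by
  have : Nonempty (Univ κ) := by
    rw [← Cardinal.mk_ne_zero_iff, Cardinal.mk_ord_toType]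
    exact (Cardinal.aleph0_pos.trans_le h0).ne'
  refine le_antisymm (le_generateFrom ?_) ?_
  · rintro _ ⟨δ, M, rfl⟩
    let _ := (fragmentTopology F (Univ κ)).induced str
    rw [isOpen_iff_mem_nhds]
    intro N hN
    -- Beyond the first cover of `N` as well as `δ`, so that the diagram also fixes the cover
    -- component of the key.
    obtain ⟨δ', hδ'⟩ := exists_gt (max δ (E.firstCover index (str N) (hX N)))
    let s : V → Univ κ := Function.invFun x
    have hs : ∀ i, s (x i) = i := Function.leftInverse_invFun hx
    have ho : IsOpen (str ⁻¹' {M | (E.diagram index x δ' (str N)).Realize M s}) :=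
      ⟨_, TopologicalSpace.isOpen_generateFrom_of_mem
        ⟨_, E.diagram_mem index x δ' hF h0 hL hμ hi (str N), s, rfl⟩, rfl⟩
    refine Filter.mem_of_superset (ho.mem_nhds ?_) fun N' hN' => ?_
    · exact (E.realize_diagram index x δ' _ _ s hs).2 ⟨rfl, fun _ _ => Iff.rfl⟩
    · obtain ⟨hb, ha⟩ := (E.realize_diagram index x δ' _ _ s hs).1 hN'
      refine Eq.trans ((E.key_eq_iff str hX hi).2 ⟨hb, ?_, fun j hj => ?_⟩) hN
      · exact ((ha.symm E).firstCover_eq E (hX N) (hX N') ((le_max_right _ _).trans_lt hδ')).symm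
      · exact ha j (hj.trans ((le_max_left _ _).trans_lt hδ'))
  · rw [fragmentTopology, induced_generateFrom_eq]
    refine le_generateFrom ?_
    rintro _ ⟨_, ⟨φ, hφ, s, rfl⟩, rfl⟩
    exact ((hT φ hφ).2 s).isOpen

/-- In the topology of a fragment, the space of canonical expansions is discrete. -/
theorem induced_expansion_eq {I : Type u} [Nonempty I] {F : Set (InfFormula E.starVocab V)}
    (hF : IsFragment μ κ F) (h0 : ℵ₀ ≤ κ) (hx : Function.Injective x) :
    (fragmentTopology F (Univ κ)).induced
      (fun M : {M : L.Structure (Univ κ) // @AEC.Mem L K (Univ κ) M} => E.expansion M.1) =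
    keyTopology fun (_ : I) M => M := by
  have : Nonempty (Univ κ) := by
    rw [← Cardinal.mk_ne_zero_iff, Cardinal.mk_ord_toType]
    exact (Cardinal.aleph0_pos.trans_le h0).ne'
  refine le_antisymm (le_generateFrom ?_) fun U _ => ?_
  · rintro _ ⟨-, M, rfl⟩
    -- The atomic formula `R_[M](a)` with `a` surjective holds in the expansion of `M` and in no
    -- other, so singletons are open.
    obtain ⟨C, a, ha, hC⟩ := E.exists_surjective_enumeratesStrong M.1 M.2
    refine ⟨_, TopologicalSpace.isOpen_generateFrom_of_mem
      ⟨E.modelAtom C x, hF.atomic _ trivial, a ∘ Function.invFun x, rfl⟩, ?_⟩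
    have hax : (a ∘ Function.invFun x) ∘ x = a := by
      rw [Function.comp_assoc, Function.invFun_comp hx, Function.comp_id]
    ext N
    change E.RelModel (E.expansion N.1) C ((a ∘ Function.invFun x) ∘ x) ↔ N = M
    rw [hax]
    refine ⟨fun h => Subtype.ext ?_, fun h => h ▸ hC⟩
    exact ((E.enumeratesStrong_iff _ _ _).1 h).1.target_unique
      ((E.enumeratesStrong_iff _ _ _).1 hC).1 ha
  · exact keyTopology_isOpen _ fun M hM => ⟨Classical.arbitrary _, fun N h => h ▸ hM⟩

end CompatibleEnum

end AECTop

/-! ### Assembly of the theorem -/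

theorem theorem4p3 {L : FirstOrder.Language.{u, u}} (K : AECTop.AEC L) (κ μ : Cardinal.{u})
    (hκ : K.IsLS κ) (hμ : μ = 2 ^ κ) (hpow : μ ^< μ = μ)
    (E : AECTop.CompatibleEnum K κ)
    (V : Type u) (hV : Order.succ κ ≤ #V)
    (x y : AECTop.Univ κ → V) (hx : Function.Injective x) (hy : Function.Injective y)
    (hxy : Disjoint (Set.range x) (Set.range y))
    (G : Type u) [AddCommGroup G] [LinearOrder G] [IsOrderedAddMonoid G]
    (hG : AECTop.deg G = μ) :
    ∃ F : Set (AECTop.InfFormula E.starVocab V),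
      -- `F` is the minimum fragment that contains the presentation theory
      IsLeast {F' | AECTop.IsFragment μ κ F' ∧ E.Theory x y ⊆ F'} F ∧
      -- the models of the theory with universe `κ` are expansions of models in `K`
      (∀ M : E.starVocab.Str (AECTop.Univ κ), AECTop.IsModel M (E.Theory x y) →
        @AECTop.AEC.Mem L K (AECTop.Univ κ) M.base) ∧
      -- each model in `K` with universe `κ` has a canonical expansion to a model of the theory
      (∀ M : L.Structure (AECTop.Univ κ), @AECTop.AEC.Mem L K (AECTop.Univ κ) M →
        AECTop.IsModel (E.expansion M) (E.Theory x y)) ∧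
      -- the space of models of the theory with universe `κ` is `G`-Polish
      AECTop.IsGPolish G ((AECTop.fragmentTopology F (AECTop.Univ κ)).induced
        (Subtype.val : {M : E.starVocab.Str (AECTop.Univ κ) //
          AECTop.IsModel M (E.Theory x y)} → E.starVocab.Str (AECTop.Univ κ))) ∧
      -- the space of models in `K` with universe `κ`, identified with their canonical expansions,
      -- is `G`-Polish
      AECTop.IsGPolish G ((AECTop.fragmentTopology F (AECTop.Univ κ)).induced
        (fun M : {M : L.Structure (AECTop.Univ κ) // @AECTop.AEC.Mem L K (AECTop.Univ κ) M} =>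
          E.expansion M.1)) := by
  open AECTop AECTop.CompatibleEnum in
  obtain ⟨⟨h0, hL, -⟩, -⟩ := hκ
  have hκμ : κ < μ := hμ ▸ Cardinal.cantor κ
  have hμ0 : ℵ₀ ≤ μ := h0.trans hκμ.le
  have hcof := cof_univ_of_powerlt hμ0 hpow
  have := Cardinal.noMaxOrder hμ0
  have nonempty : ∀ {c : Cardinal.{u}}, ℵ₀ ≤ c → Nonempty (Univ c) := fun h => by
    rw [← Cardinal.mk_ne_zero_iff, Cardinal.mk_ord_toType]
    exact (Cardinal.aleph0_pos.trans_le h).ne'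
  have := nonempty h0
  have := nonempty hμ0
  obtain ⟨index, hi⟩ : ∃ index : E.Instance → Univ μ, Function.Injective index := by
    have : #E.Instance ≤ #(Univ μ) := by
      rw [Cardinal.mk_ord_toType, hμ]
      exact E.mk_instance_le h0 hL
    obtain ⟨e⟩ := this
    exact ⟨e, e.injective⟩
  have hiff := E.isModel_iff_presents hx hy hxy
  let str : {M : E.starVocab.Str (Univ κ) // IsModel M (E.Theory x y)} →
    E.starVocab.Str (Univ κ) := Subtype.val
  have hX : ∀ M, E.Presents (str M) := fun M => (hiff M.1).1 M.2
  have mono := E.refines_key str hX hi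
  have hd := E.decidesAtoms_key str hX hi
  have hfrag : IsFragment μ κ
      {φ : InfFormula E.starVocab V | BoundedTame μ κ (E.key index str hX) str φ} :=
    isFragment_tame mono h0 hd (E.mk_arity_le h0)
      (by rwa [hcof, Cardinal.mk_ord_toType]) hcof.ge
  have hsub := E.theory_subset_boundedTame (fun M => M.2) mono hd
    (E.isDecided_exists_relModel str hX hi) h0 (hκμ.trans_eq hcof.symm) hκμ.le
    ((E.mk_modelType_le h0 hL).trans_eq hμ.symm)
  have hleast := isLeast_sInter_fragment hfrag hsub
  refine ⟨_, hleast, fun M hM => ((hiff M).1 hM).mem E,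
    fun M hM => (hiff _).2 (E.presents_expansion M hM), ?_, ?_⟩
  -- Minimality is used here: it places `F` inside the tame fragment, so its formulas define open
  -- sets of the key topology.
  · rw [E.induced_fragmentTopology_eq index x hleast.1.1 h0 hL hκμ hi str hX hx
      fun φ hφ => (hleast.2 ⟨hfrag, hsub⟩ hφ).2.self]
    subst hG
    refine isGPolish_keyTopology G hμ0 _ mono
      (E.key_separating str hX hi Subtype.val_injective) (fun xs hxs => ?_)
      (E.mk_range_key_le str hX h0 hL hμ hpow)
    obtain ⟨N, hN, hlim⟩ := E.exists_limit str hX hi xs hxs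
    exact ⟨⟨N, (hiff N).2 hN⟩, fun δ => (hlim δ).imp fun α h β hβ =>
      (E.key_eq_iff str hX hi).2 (h β hβ)⟩
  · subst hG
    -- The discrete space is given by the constant sequence of identity keys: eventual agreement
    -- means eventual constancy, and there are at most `2 ^ κ` points.
    rw [E.induced_expansion_eq x (I := Univ (deg G)) hleast.1.1 h0 hx]
    refine isGPolish_keyTopology G hμ0 _ (fun _ _ _ _ _ h => h)
      (fun M N h => h (Classical.arbitrary _)) (fun xs hxs => ?_) fun _ => ?_
    · obtain ⟨α, hα⟩ := hxs (Classical.arbitrary _)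
      exact ⟨xs α, fun _ => ⟨α, fun β hβ => hα β α hβ le_rfl⟩⟩
    · exact ((Cardinal.mk_set_le _).trans (Cardinal.mk_subtype_le _)).trans
        ((mk_structure_le h0 hL).trans_eq hμ.symm)
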